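/- **Setting.** Let $\mathcal E_\theta$ ($\theta\in\mathbb R$) be quantum channels from a system $I$ to a system $O$ (finite-dimensional, nonzero), with Choi operators $C_\theta=\sum_{i,j}|i\rangle\langle j|\otimes\mathcal E_\theta(|i\rangle\langle j|)$ depending measurably on $\theta$, and let $\mu$ be a prior probability measure for $\theta$ with $\int|\theta|\,d\mu<\infty$ (for instance $d\mu=p(\theta)d\theta$). Fix $N$; let $I_1,\dots,I_N$ and $O_1,\dots,O_N$ be copies of $I$ and $O$, and $d_O=(\dim O)^N$. A strategy with final output space $F$ (finite-dimensional) is a positive semidefinite operator $X$ on $I_1O_1\cdots I_NO_N\otimes F$; put $\tilde X=\mathrm{tr}_F X$. It is of type * $(i)$ (parallel) if $\tilde X=\sigma_{I_1\cdots I_N}\otimes\mathbb I_{O_1\cdots O_N}$ with $\mathrm{tr}\,\sigma=1$; * $(ii)$ (sequential) if $\tilde X$ is a normalized quantum comb, i.e. there are $V_1,\dots,V_N$ with $\tilde X=V_N\otimes\mathbb I_{O_N}$, $\mathrm{tr}_{I_j}V_j=V_{j-1}\otimes\mathbb I_{O_{j-1}}$ for $2\le j\le N$, and $\mathrm{tr}_{I_1}V_1=1$;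 * $(iv)$ (general, possibly indefinite causal order) if $\mathrm{tr}\,[X\star(D_1\otimes\cdots\otimes D_N)]=1$ for the Choi operators $D_j$ of arbitrary channels from $I_j$ to $O_j$. Here $X\star D=\mathrm{tr}_{I_1O_1\cdots I_NO_N}[X(D^T\otimes\mathbb I_F)]$. Let $\tilde{\mathbb X}^{(k)}$ be the set of all $\tilde X=\mathrm{tr}_FX$ with $X$ of type $k$. The strategy $X$ produces the states $\rho_\theta=X\star C_\theta^{\otimes N}$. With $\bar\rho=\int\rho_\theta\,d\mu$ and $\overline{\theta\rho}=\int\theta\rho_\theta\,d\mu$, the information it gains is $\mathcal J(X)=\mathrm{tr}(\bar\rho S^2)$, where $S$ is Hermitian with $\overline{\theta\rho}=\frac12(\bar\rho S+S\bar\rho)$. Let $\mathcal J_{\max}^{(k)}$ be the supremum of $\mathcal J(X)$ over all strategies of type $k$. Let $\bar C=\int C_\theta^{\otimes N}d\mu$, let $H$ be any Hermitian operator with $-(H\bar C+\bar CH)=\int\theta\, C_\theta^{\otimes N}d\mu$, and let $\Phi$ be any matrix with $q$ columns such that $\Phi\Phi^\dagger=\bar C$. For Hermitian $q\times q$ matrices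 $h$ put $\Omega(h)=4(H^*\Phi^*-i\Phi^*h)(H^*\Phi^*-i\Phi^*h)^\dagger$, where $*$ is the entrywise complex conjugate. For a subsystem $Q$ write $Q$ also for the map ${}_Q\tilde X=\mathrm{tr}_Q\tilde X\otimes\mathbb I_Q/d_Q$; products are compositions. Let $$\Lambda^{(i)}=\prod_jO_j,\qquad \Lambda^{(ii)}=1-\sum_{j=1}^N(1-O_j)\prod_{l>j}I_lO_l,\qquad \Lambda^{(iv)}=1-\prod_j(1-O_j+I_jO_j)+\prod_jI_jO_j .$$ **Theorem.** For $k=i,ii,iv$ the supremum $\mathcal J_{\max}^{(k)}$ is finite and $$\mathcal J_{\max}^{(k)}=\max_{\tilde X\in\tilde{\mathbb X}^{(k)}}\ \min_{h=h^\dagger}\ \mathrm{tr}[\tilde X\,\Omega(h)],$$ and $\mathcal J_{\max}^{(k)}$ equals the optimum, which is attained, of the semidefinite program $$\max_{\tilde X,B,C}\ -\mathrm{tr}\,C-4\,\mathrm{Re}\,\mathrm{tr}(H^*\Phi^*B)\quad\text{s.t.}\quad \Lambda^{(k)}(\tilde X)=\tilde X,\quad \mathrm{tr}\,\tilde X=d_O,\quad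 \begin{bmatrix}\tilde X&B^\dagger\\B&C\end{bmatrix}\ge0,\quad B\Phi^*\ \text{Hermitian}.$$ -/

import Mathlib

open Matrix MeasureTheory
open scoped ComplexOrder

noncomputable section

namespace GlobalEstimation

variable {I O F : Type*} [Fintype I] [DecidableEq I] [Fintype O] [DecidableEq O] [Fintype F]

/-! Index conventions: `I` and `O` index orthonormal bases of the input and output space of one
query of the channel. The basis of the tensor product of all `I_j` and `O_j`, `j < N`, is indexed
by `Fin N → I × O`. Operators are complex matrices. -/

/-- Entrywise complex conjugate of a matrix. -/
def conj {m n : Type*} (A : Matrix m n ℂ) : Matrix m n ℂ := A.map (starRingEnd ℂ)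

/-! ### Channels -/

/-- The map `id ⊗ E` on matrices over `Fin d × I`. -/
def ampliation (E : Matrix I I ℂ →ₗ[ℂ] Matrix O O ℂ) (d : ℕ)
    (M : Matrix (Fin d × I) (Fin d × I) ℂ) : Matrix (Fin d × O) (Fin d × O) ℂ :=
  Matrix.of fun a b => E (Matrix.of fun i j => M (a.1, i) (b.1, j)) a.2 b.2

/-- A quantum channel: a completely positive and trace-preserving linear map. -/
structure IsChannel (E : Matrix I I ℂ →ₗ[ℂ] Matrix O O ℂ) : Prop where
  completelyPositive : ∀ (d : ℕ) (M : Matrix (Fin d × I) (Fin d × I) ℂ),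
    M.PosSemidef → (ampliation E d M).PosSemidef
  tracePreserving : ∀ ρ : Matrix I I ℂ, (E ρ).trace = ρ.trace

/-- The Choi operator `∑ i j, |i⟩⟨j| ⊗ E(|i⟩⟨j|)`. -/
def choi (E : Matrix I I ℂ →ₗ[ℂ] Matrix O O ℂ) : Matrix (I × O) (I × O) ℂ :=
  Matrix.of fun a b => E (Matrix.single a.1 b.1 1) a.2 b.2

/-- The tensor product of `N` operators, the `j`-th one acting on `I_j` and `O_j`. -/
def tensor {N : ℕ} (C : Fin N → Matrix (I × O) (I × O) ℂ) :
    Matrix (Fin N → I × O) (Fin N → I × O) ℂ :=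
  Matrix.of fun x y => ∏ j, C j (x j) (y j)

/-! ### Strategies -/

/-- The partial trace over the final output space. -/
def traceF {n : Type*} (X : Matrix (n × F) (n × F) ℂ) : Matrix n n ℂ :=
  Matrix.of fun x y => ∑ f, X (x, f) (y, f)

/-- The link product `X ⋆ C = tr_{IO} [X (Cᵀ ⊗ 1_F)]`. -/
def link {n : Type*} [Fintype n] (X : Matrix (n × F) (n × F) ℂ) (C : Matrix n n ℂ) :
    Matrix F F ℂ :=
  Matrix.of fun f g => ∑ x, ∑ y, X (x, f) (y, g) * C x y

/-- The normalization of a quantum comb with `N` slots, used in the order `0, 1, …, N - 1`: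
`W = V ⊗ 1` on the last output space, and tracing the last input space out of `V` leaves a
normalized comb with one slot less; the comb without slots is the number `1`. -/
def IsComb : (N : ℕ) → Matrix (Fin N → I × O) (Fin N → I × O) ℂ → Prop
  | 0, W => W = 1
  | N + 1, W =>
      ∃ V : Matrix ((Fin N → I × O) × I) ((Fin N → I × O) × I) ℂ,
        (∀ x y i i' o o', W (Fin.snoc x (i, o)) (Fin.snoc y (i', o')) =
          if o = o' then V (x, i) (y, i') else 0) ∧
        IsComb N (traceF V)

/-- The classes (i), (ii) and (iv) of strategies. -/
inductive StrategyType
  | parallel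
  | sequential
  | indefinite

/-- `X`, the Choi operator of a process with the `N` open slots `I_j → O_j` and with final output
`F`, is a strategy of the given type:
* parallel: `tr_F X = σ ⊗ 1_{O_1 ⋯ O_N}` for an operator `σ` on the inputs with trace one;
* sequential: `tr_F X` is a normalized quantum comb;
* general, the causal order may be indefinite: inserting any `N` channels gives a state. -/
def IsStrategy {N : ℕ} (k : StrategyType)
    (X : Matrix ((Fin N → I × O) × F) ((Fin N → I × O) × F) ℂ) : Prop :=
  X.PosSemidef ∧
  match k with
  | .parallel => ∃ σ : Matrix (Fin N → I) (Fin N → I) ℂ, σ.trace = 1 ∧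
      ∀ x y, traceF X x y =
        if (fun j => (x j).2) = (fun j => (y j).2) then
          σ (fun j => (x j).1) (fun j => (y j).1) else 0
  | .sequential => IsComb N (traceF X)
  | .indefinite => ∀ E : Fin N → (Matrix I I ℂ →ₗ[ℂ] Matrix O O ℂ), (∀ j, IsChannel (E j)) →
      (link X (tensor fun j => choi (E j))).trace = 1

/-- The set of the operators `tr_F X`, with `X` a strategy of type `k` and `F` of any finite
dimension. -/
def reducedStrategies (I O : Type*) [Fintype I] [DecidableEq I] [Fintype O] [DecidableEq O]
    (N : ℕ) (k : StrategyType) : Set (Matrix (Fin N → I × O) (Fin N → I × O) ℂ) :=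
  {W | ∃ (f : ℕ) (X : Matrix ((Fin N → I × O) × Fin f) ((Fin N → I × O) × Fin f) ℂ),
    IsStrategy k X ∧ W = traceF X}

/-! ### Bayesian estimation of `θ` with prior `μ` from `N` queries of the channel `E θ` -/

/-- The state produced by the strategy `X` if the parameter is `θ`. -/
def outputState {N : ℕ} (E : ℝ → (Matrix I I ℂ →ₗ[ℂ] Matrix O O ℂ))
    (X : Matrix ((Fin N → I × O) × F) ((Fin N → I × O) × F) ℂ) (θ : ℝ) : Matrix F F ℂ :=
  link X (tensor fun _ => choi (E θ))

/-- The average, entry by entry, of a matrix that depends on the parameter. -/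
def average {n : Type*} (μ : Measure ℝ) (A : ℝ → Matrix n n ℂ) : Matrix n n ℂ :=
  Matrix.of fun x y => ∫ θ, A θ x y ∂μ

/-- `v` is the information `tr (ρ̄ S²)` gained by the strategy `X`, where the Hermitian operator `S`
solves `∫ θ ρ_θ dμ = (ρ̄ S + S ρ̄) / 2`. -/
def IsInformation {N : ℕ} (μ : Measure ℝ) (E : ℝ → (Matrix I I ℂ →ₗ[ℂ] Matrix O O ℂ))
    (X : Matrix ((Fin N → I × O) × F) ((Fin N → I × O) × F) ℂ) (v : ℝ) : Prop :=
  ∃ S : Matrix F F ℂ, S.IsHermitian ∧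
    average μ (fun θ => (θ : ℂ) • outputState E X θ) =
      (1 / 2 : ℂ) • (average μ (outputState E X) * S + S * average μ (outputState E X)) ∧
    v = (average μ (outputState E X) * (S * S)).trace.re

/-- All values of the information gained by strategies of type `k`. -/
def informationValues (N : ℕ) (k : StrategyType) (μ : Measure ℝ)
    (E : ℝ → (Matrix I I ℂ →ₗ[ℂ] Matrix O O ℂ)) : Set ℝ :=
  {v | ∃ (f : ℕ) (X : Matrix ((Fin N → I × O) × Fin f) ((Fin N → I × O) × Fin f) ℂ),
    IsStrategy k X ∧ IsInformation μ E X v}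

/-- The maximal information `J_max^(k)`. -/
def maxInformation (N : ℕ) (k : StrategyType) (μ : Measure ℝ)
    (E : ℝ → (Matrix I I ℂ →ₗ[ℂ] Matrix O O ℂ)) : ℝ :=
  sSup (informationValues N k μ E)

/-- `C̄`, the average of the Choi operator of `N` queries. -/
def avgChoi (N : ℕ) (μ : Measure ℝ) (E : ℝ → (Matrix I I ℂ →ₗ[ℂ] Matrix O O ℂ)) :
    Matrix (Fin N → I × O) (Fin N → I × O) ℂ :=
  average μ fun θ => tensor fun _ => choi (E θ)

/-- The average of `θ` times the Choi operator of `N` queries. -/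
def avgThetaChoi (N : ℕ) (μ : Measure ℝ) (E : ℝ → (Matrix I I ℂ →ₗ[ℂ] Matrix O O ℂ)) :
    Matrix (Fin N → I × O) (Fin N → I × O) ℂ :=
  average μ fun θ => (θ : ℂ) • tensor fun _ => choi (E θ)

/-! ### The maps `Λ^(k)` -/

/-- Trace out the subsystem `I_j` and replace it by the normalized identity. -/
def replaceI {N : ℕ} (j : Fin N) :
    Module.End ℂ (Matrix (Fin N → I × O) (Fin N → I × O) ℂ) where
  toFun X := Matrix.of fun x y =>
    if (x j).1 = (y j).1 then
      (Fintype.card I : ℂ)⁻¹ *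
        ∑ i, X (Function.update x j (i, (x j).2)) (Function.update y j (i, (y j).2))
    else 0
  map_add' X Y := by
    ext x y
    simp only [Matrix.of_apply, Matrix.add_apply, Finset.sum_add_distrib, mul_add]
    split_ifs <;> simp
  map_smul' c X := by
    ext x y
    simp only [Matrix.of_apply, Matrix.smul_apply, smul_eq_mul, RingHom.id_apply,
      ← Finset.mul_sum]
    split_ifs
    · ring
    · simp

/-- Trace out the subsystem `O_j` and replace it by the normalized identity. -/
def replaceO {N : ℕ} (j : Fin N) :
    Module.End ℂ (Matrix (Fin N → I × O) (Fin N → I × O) ℂ) where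
  toFun X := Matrix.of fun x y =>
    if (x j).2 = (y j).2 then
      (Fintype.card O : ℂ)⁻¹ *
        ∑ o, X (Function.update x j ((x j).1, o)) (Function.update y j ((y j).1, o))
    else 0
  map_add' X Y := by
    ext x y
    simp only [Matrix.of_apply, Matrix.add_apply, Finset.sum_add_distrib, mul_add]
    split_ifs <;> simp
  map_smul' c X := by
    ext x y
    simp only [Matrix.of_apply, Matrix.smul_apply, smul_eq_mul, RingHom.id_apply,
      ← Finset.mul_sum]
    split_ifs
    · ring
    · simp

/-- The maps `Λ^(k)`; products are compositions (of commuting maps).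
* parallel: `∏ j, O_j`;
* sequential: `O_N - ∑_{j < N} (1 - O_j) ∏_{l > j} I_l O_l`, where `O_N = 1 - (1 - O_N)` is written
  as part of a sum over all `j`;
* general: `1 - ∏ j, (1 - O_j + I_j O_j) + ∏ j, I_j O_j`. -/
def Lam (N : ℕ) : StrategyType → Module.End ℂ (Matrix (Fin N → I × O) (Fin N → I × O) ℂ)
  | .parallel => ((List.finRange N).map replaceO).prod
  | .sequential => 1 - ∑ j : Fin N, (1 - replaceO j) *
      (((List.finRange N).filter fun l => j < l).map fun l => replaceI l * replaceO l).prod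
  | .indefinite =>
      1 - ((List.finRange N).map fun j => 1 - replaceO j + replaceI j * replaceO j).prod
        + ((List.finRange N).map fun j => replaceI j * replaceO j).prod

/-! ### The optimization problems -/

/-- `Ω(h) = 4 (H* Φ* - i Φ* h) (H* Φ* - i Φ* h)†`. -/
def Omega {n : Type*} [Fintype n] {q : ℕ} (H : Matrix n n ℂ) (Φ : Matrix n (Fin q) ℂ)
    (h : Matrix (Fin q) (Fin q) ℂ) : Matrix n n ℂ :=
  (4 : ℂ) • ((conj H * conj Φ - Complex.I • (conj Φ * h)) *
    (conj H * conj Φ - Complex.I • (conj Φ * h))ᴴ)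

/-- The numbers `min_h tr (W Ω(h))`, the minimum taken over Hermitian `h`, for all `W = tr_F X` with
`X` a strategy of type `k`. -/
def minValues {N q : ℕ} (k : StrategyType) (H : Matrix (Fin N → I × O) (Fin N → I × O) ℂ)
    (Φ : Matrix (Fin N → I × O) (Fin q) ℂ) : Set ℝ :=
  {v | ∃ W ∈ reducedStrategies I O N k,
    IsLeast {t : ℝ | ∃ h : Matrix (Fin q) (Fin q) ℂ, h.IsHermitian ∧
      t = (W * Omega H Φ h).trace.re} v}

/-- The feasible points `(X̃, B, C)` of the primal semidefinite program. -/
structure IsFeasible {N q : ℕ} (k : StrategyType) (Φ : Matrix (Fin N → I × O) (Fin q) ℂ)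
    (X : Matrix (Fin N → I × O) (Fin N → I × O) ℂ) (B : Matrix (Fin q) (Fin N → I × O) ℂ)
    (C : Matrix (Fin q) (Fin q) ℂ) : Prop where
  fixed : Lam N k X = X
  trace_eq : X.trace = (Fintype.card O : ℂ) ^ N
  posSemidef : (Matrix.fromBlocks X Bᴴ B C).PosSemidef
  hermitian : (B * conj Φ).IsHermitian

/-- The values of the objective `-tr C - 4 Re tr (H* Φ* B)` at the feasible points. -/
def primalValues {N q : ℕ} (k : StrategyType) (H : Matrix (Fin N → I × O) (Fin N → I × O) ℂ)
    (Φ : Matrix (Fin N → I × O) (Fin q) ℂ) : Set ℝ :=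
  {v | ∃ X B C, IsFeasible k Φ X B C ∧
    v = -C.trace.re - 4 * (conj H * conj Φ * B).trace.re}

end GlobalEstimation

end

set_option linter.unusedSectionVars false

noncomputable section

namespace GlobalEstimation

variable {I O : Type*} [Fintype I] [DecidableEq I] [Fintype O] [DecidableEq O]

/-! ### Operators determined by their values on tensor products -/

/-! Write `C` and `Θ` for the averages of the `N`-query Choi operator and of `θ` times it. For
Hermitian `h` the matrix `Y = H Φ + i Φ h*` satisfies `Y Φ† + Φ Y† = -Θ`, because the contributions
of `h` cancel. Split a strategy as `X = ∑ |l_k⟩⟨l_k|`, each `l_k` read as a matrix, and let `W =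
tr_F X`. Then `tr (W Ω(h)) = 4 ∑ ‖l_kᵀ Y‖²`, and by the equation defining `S` the nonnegative sum `∑
‖2 l_kᵀ Y + S l_kᵀ Φ‖²` equals `tr (W Ω(h)) - J(X)`. Hence `J(X) ≤ tr (W Ω(h))` for every `h`
(`information_le`).

Equality is reached by the purification `W = L L†`. With `G = Lᵀ Φ` and `K = Lᵀ Y`, minimality in
`h` says exactly that `G† K` is Hermitian, and this is what allows a Hermitian `S` with `S G = -2 K`
(`exists_isHermitian_mul_eq`), provided that the left kernel of `G` kills `K`. Positivity of all the
Choi operators gives this: `U C = 0` forces `U Θ = 0`, hence `U H Φ = 0`. The same `K` yields `B`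
and the lower right block of an optimal point of the semidefinite program with the same value
(`exists_information_eq`); weak duality bounds all other points (`le_of_posSemidef_fromBlocks`). So
for each fixed `W` the three problems have the same value, and no minimax theorem is needed.

It remains to see that the operators `tr_F X` are exactly the positive `W` with `Λ W = W` and `tr W
= d_O` (`isParallel_iff`, `isComb_iff`, `indefinite_iff`), and that the maximum over `W` is
attained: this set is compact and nonempty, and a minimum of functions linear in `W` is upper
semicontinuous. -/

theorem tensor_eq_mul_prod_erase {N : ℕ} (D : Fin N → Matrix (I × O) (I × O) ℂ) (j : Fin N)
    (x y : Fin N → I × O) :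
    tensor D x y = D j (x j) (y j) * ∏ k ∈ Finset.univ.erase j, D k (x k) (y k) :=
  (Finset.mul_prod_erase _ _ (Finset.mem_univ j)).symm

theorem tensor_update {N : ℕ} (D : Fin N → Matrix (I × O) (I × O) ℂ) (j : Fin N)
    (A : Matrix (I × O) (I × O) ℂ) (x y : Fin N → I × O) :
    tensor (Function.update D j A) x y =
      A (x j) (y j) * ∏ k ∈ Finset.univ.erase j, D k (x k) (y k) := by
  rw [tensor_eq_mul_prod_erase _ j, Function.update_self]
  congr 1
  refine Finset.prod_congr rfl fun k hk => ?_
  rw [Function.update_of_ne (Finset.ne_of_mem_erase hk)]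

theorem tensor_apply_update {N : ℕ} (D : Fin N → Matrix (I × O) (I × O) ℂ) (j : Fin N)
    (x y : Fin N → I × O) (a b : I × O) :
    tensor D (Function.update x j a) (Function.update y j b) =
      D j a b * ∏ k ∈ Finset.univ.erase j, D k (x k) (y k) := by
  rw [tensor_eq_mul_prod_erase _ j, Function.update_self, Function.update_self]
  congr 1
  refine Finset.prod_congr rfl fun k hk => ?_
  rw [Function.update_of_ne (Finset.ne_of_mem_erase hk),
    Function.update_of_ne (Finset.ne_of_mem_erase hk)]

theorem single_eq_tensor {N : ℕ} (x y : Fin N → I × O) :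
    single x y (1 : ℂ) = tensor fun j => single (x j) (y j) (1 : ℂ) := by
  ext a b
  simp only [tensor, Matrix.of_apply, single_apply]
  rw [Finset.prod_ite_zero]
  simp [funext_iff, forall_and]

/-- Matrix units are product operators. This reduces identities between the maps `replaceI`,
`replaceO` and their products to computations on one slot. -/
theorem linearMap_ext_tensor {N : ℕ} {M : Type*} [AddCommMonoid M] [Module ℂ M]
    {f g : Matrix (Fin N → I × O) (Fin N → I × O) ℂ →ₗ[ℂ] M}
    (h : ∀ D, f (tensor D) = g (tensor D)) : f = g := by
  refine Matrix.ext_linearMap ℂ fun x y => LinearMap.ext_ring ?_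
  simpa [single_eq_tensor] using h _

/-- The map `replaceI` on one slot. -/
def siteI : Module.End ℂ (Matrix (I × O) (I × O) ℂ) where
  toFun D := Matrix.of fun a b =>
    if a.1 = b.1 then (Fintype.card I : ℂ)⁻¹ * ∑ i, D (i, a.2) (i, b.2) else 0
  map_add' X Y := by
    ext x y
    simp only [Matrix.of_apply, Matrix.add_apply, Finset.sum_add_distrib, mul_add]
    split_ifs <;> simp
  map_smul' c X := by
    ext x y
    simp only [Matrix.of_apply, Matrix.smul_apply, smul_eq_mul, RingHom.id_apply,
      ← Finset.mul_sum]
    split_ifs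
    · ring
    · simp

/-- The map `replaceO` on one slot. -/
def siteO : Module.End ℂ (Matrix (I × O) (I × O) ℂ) where
  toFun D := Matrix.of fun a b =>
    if a.2 = b.2 then (Fintype.card O : ℂ)⁻¹ * ∑ o, D (a.1, o) (b.1, o) else 0
  map_add' X Y := by
    ext x y
    simp only [Matrix.of_apply, Matrix.add_apply, Finset.sum_add_distrib, mul_add]
    split_ifs <;> simp
  map_smul' c X := by
    ext x y
    simp only [Matrix.of_apply, Matrix.smul_apply, smul_eq_mul, RingHom.id_apply,
      ← Finset.mul_sum]
    split_ifs
    · ring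
    · simp

theorem siteI_apply (D : Matrix (I × O) (I × O) ℂ) (a b : I × O) : siteI D a b =
    if a.1 = b.1 then (Fintype.card I : ℂ)⁻¹ * ∑ i, D (i, a.2) (i, b.2) else 0 := rfl

theorem siteO_apply (D : Matrix (I × O) (I × O) ℂ) (a b : I × O) : siteO D a b =
    if a.2 = b.2 then (Fintype.card O : ℂ)⁻¹ * ∑ o, D (a.1, o) (b.1, o) else 0 := rfl

theorem replaceI_apply {N : ℕ} (j : Fin N) (X : Matrix (Fin N → I × O) (Fin N → I × O) ℂ)
    (x y : Fin N → I × O) : replaceI j X x y = if (x j).1 = (y j).1 then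
      (Fintype.card I : ℂ)⁻¹ *
        ∑ i, X (Function.update x j (i, (x j).2)) (Function.update y j (i, (y j).2))
    else 0 := rfl

theorem replaceO_apply {N : ℕ} (j : Fin N) (X : Matrix (Fin N → I × O) (Fin N → I × O) ℂ)
    (x y : Fin N → I × O) : replaceO j X x y = if (x j).2 = (y j).2 then
      (Fintype.card O : ℂ)⁻¹ *
        ∑ o, X (Function.update x j ((x j).1, o)) (Function.update y j ((y j).1, o))
    else 0 := rfl

theorem replaceI_tensor {N : ℕ} (j : Fin N) (D : Fin N → Matrix (I × O) (I × O) ℂ) :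
    replaceI j (tensor D) = tensor (Function.update D j (siteI (D j))) := by
  ext x y
  rw [replaceI_apply, tensor_update, siteI_apply]
  simp only [tensor_apply_update, ← Finset.sum_mul]
  split_ifs <;> ring

theorem replaceO_tensor {N : ℕ} (j : Fin N) (D : Fin N → Matrix (I × O) (I × O) ℂ) :
    replaceO j (tensor D) = tensor (Function.update D j (siteO (D j))) := by
  ext x y
  rw [replaceO_apply, tensor_update, siteO_apply]
  simp only [tensor_apply_update, ← Finset.sum_mul]
  split_ifs <;> ring

theorem siteO_mul_siteO [Nonempty O] :
    (siteO * siteO : Module.End ℂ (Matrix (I × O) (I × O) ℂ)) = siteO := by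
  ext D a b
  simp only [Module.End.mul_apply, siteO_apply]
  simp

theorem siteI_siteO (D : Matrix (I × O) (I × O) ℂ) :
    siteI (siteO D) = ((Fintype.card I : ℂ)⁻¹ * (Fintype.card O : ℂ)⁻¹ * D.trace) • (1 : Matrix (I × O) (I × O) ℂ) := by
  ext a b
  simp only [siteO_apply, siteI_apply, Matrix.trace, Fintype.sum_prod_type,
    Matrix.smul_apply, Matrix.one_apply, Prod.ext_iff, Matrix.diag, smul_eq_mul]
  by_cases h1 : a.1 = b.1 <;> by_cases h2 : a.2 = b.2 <;> simp [h1, h2, Finset.mul_sum, mul_assoc]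

/-- The endomorphism `T` acts as `t` on the `j`-th tensor factor. -/
def ActsOn {N : ℕ} (j : Fin N) (T : Module.End ℂ (Matrix (Fin N → I × O) (Fin N → I × O) ℂ))
    (t : Module.End ℂ (Matrix (I × O) (I × O) ℂ)) : Prop :=
  ∀ D, T (tensor D) = tensor (Function.update D j (t (D j)))

theorem actsOn_replaceI {N : ℕ} (j : Fin N) : ActsOn (I := I) (O := O) j (replaceI j) siteI :=
  replaceI_tensor j

theorem actsOn_replaceO {N : ℕ} (j : Fin N) : ActsOn (I := I) (O := O) j (replaceO j) siteO :=
  replaceO_tensor j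

namespace ActsOn

variable {N : ℕ} {j : Fin N} {S T : Module.End ℂ (Matrix (Fin N → I × O) (Fin N → I × O) ℂ)}
  {s t : Module.End ℂ (Matrix (I × O) (I × O) ℂ)}

theorem one : ActsOn (I := I) (O := O) j 1 1 := fun D => by simp

theorem mul (hS : ActsOn j S s) (hT : ActsOn j T t) : ActsOn j (S * T) (s * t) := fun D => by
  rw [Module.End.mul_apply, hT, hS, Function.update_self, Function.update_idem]
  rfl

theorem add (hS : ActsOn j S s) (hT : ActsOn j T t) : ActsOn j (S + T) (s + t) := fun D => by
  ext x y
  rw [LinearMap.add_apply, hS, hT, Matrix.add_apply, tensor_update, tensor_update, tensor_update,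
    LinearMap.add_apply, Matrix.add_apply, add_mul]

theorem sub (hS : ActsOn j S s) (hT : ActsOn j T t) : ActsOn j (S - T) (s - t) := fun D => by
  ext x y
  rw [LinearMap.sub_apply, hS, hT, Matrix.sub_apply, tensor_update, tensor_update, tensor_update,
    LinearMap.sub_apply, Matrix.sub_apply, sub_mul]

theorem eq (hS : ActsOn j S s) (hT : ActsOn j T s) : S = T :=
  linearMap_ext_tensor fun D => (hS D).trans (hT D).symm

/-- Without repetitions in the list every listed factor is hit exactly once, so `s` need not be
idempotent. -/
theorem list_prod {R : Fin N → Module.End ℂ (Matrix (Fin N → I × O) (Fin N → I × O) ℂ)}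
    (hR : ∀ j, ActsOn j (R j) s) (l : List (Fin N)) (hl : l.Nodup)
    (D : Fin N → Matrix (I × O) (I × O) ℂ) :
    (l.map R).prod (tensor D) = tensor fun j => if j ∈ l then s (D j) else D j := by
  induction l with
  | nil => simp
  | cons a l ih =>
    rw [List.nodup_cons] at hl
    rw [List.map_cons, List.prod_cons, Module.End.mul_apply, ih hl.2, hR]
    congr 1
    funext j
    by_cases hj : j = a
    · subst hj
      simp [hl.1]
    · simp [hj]

theorem list_prod_finRange {R : Fin N → Module.End ℂ (Matrix (Fin N → I × O) (Fin N → I × O) ℂ)}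
    (hR : ∀ j, ActsOn j (R j) s) (D : Fin N → Matrix (I × O) (I × O) ℂ) :
    ((List.finRange N).map R).prod (tensor D) = tensor fun j => s (D j) := by
  rw [list_prod hR _ (List.nodup_finRange N)]
  simp

end ActsOn

/-! ### The condition for parallel strategies -/

/-- Normalization of the reduced operator of a parallel strategy. -/
def IsParallel {N : ℕ} (W : Matrix (Fin N → I × O) (Fin N → I × O) ℂ) : Prop :=
  ∃ σ : Matrix (Fin N → I) (Fin N → I) ℂ, σ.trace = 1 ∧
    ∀ x y, W x y = if (fun j => (x j).2) = (fun j => (y j).2) then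
      σ (fun j => (x j).1) (fun j => (y j).1) else 0

theorem trace_tensor {N : ℕ} (D : Fin N → Matrix (I × O) (I × O) ℂ) :
    (tensor D).trace = ∏ j, (D j).trace := by
  simp only [Matrix.trace, Matrix.diag, tensor, Matrix.of_apply]
  rw [Finset.prod_univ_sum, Fintype.piFinset_univ]

/-- The linear map `W ↦ tr_O W / d_O ^ N ⊗ 1_O`. -/
def replaceAllO (N : ℕ) : Module.End ℂ (Matrix (Fin N → I × O) (Fin N → I × O) ℂ) where
  toFun W := Matrix.of fun x y => if (fun j => (x j).2) = (fun j => (y j).2) then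
    ((Fintype.card O : ℂ)⁻¹) ^ N * ∑ o : Fin N → O, W (fun j => ((x j).1, o j))
      (fun j => ((y j).1, o j)) else 0
  map_add' X Y := by
    ext x y
    simp only [Matrix.of_apply, Matrix.add_apply, Finset.sum_add_distrib, mul_add]
    split_ifs <;> simp
  map_smul' c X := by
    ext x y
    simp only [Matrix.of_apply, Matrix.smul_apply, smul_eq_mul, RingHom.id_apply,
      ← Finset.mul_sum]
    split_ifs
    · ring
    · simp

/-- On a product operator, the product of the single-slot sums expands to a sum over output tuples,
and the product of the indicators is the indicator of equal tuples. -/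
theorem Lam_parallel (N : ℕ) : Lam (I := I) (O := O) N .parallel = replaceAllO N := by
  refine linearMap_ext_tensor fun D => ?_
  simp only [Lam]
  rw [ActsOn.list_prod_finRange actsOn_replaceO]
  ext x y
  simp only [replaceAllO, tensor, LinearMap.coe_mk, AddHom.coe_mk, Matrix.of_apply, siteO_apply]
  rw [Finset.prod_ite_zero, Finset.prod_mul_distrib, Finset.prod_univ_sum, Fintype.piFinset_univ]
  simp [funext_iff]

theorem trace_of_parallel {N : ℕ} (W : Matrix (Fin N → I × O) (Fin N → I × O) ℂ)
    (σ : Matrix (Fin N → I) (Fin N → I) ℂ)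
    (h : ∀ x y, W x y = if (fun j => (x j).2) = (fun j => (y j).2) then
      σ (fun j => (x j).1) (fun j => (y j).1) else 0) :
    W.trace = (Fintype.card O : ℂ) ^ N * σ.trace := by
  simp only [Matrix.trace, Matrix.diag, h, if_true]
  rw [← (Equiv.arrowProdEquivProdArrow (Fin N) (fun _ => I) (fun _ => O)).symm.sum_comp]
  simp [Fintype.sum_prod_type, Equiv.arrowProdEquivProdArrow, Finset.mul_sum]

theorem isParallel_iff [Nonempty O] {N : ℕ} (W : Matrix (Fin N → I × O) (Fin N → I × O) ℂ) :
    IsParallel W ↔ Lam N .parallel W = W ∧ W.trace = (Fintype.card O : ℂ) ^ N := by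
  have hO : (Fintype.card O : ℂ) ≠ 0 := by simp
  rw [Lam_parallel]
  constructor
  · rintro ⟨σ, hσ, h⟩
    refine ⟨?_, by rw [trace_of_parallel W σ h, hσ, mul_one]⟩
    ext x y
    simp only [replaceAllO, LinearMap.coe_mk, AddHom.coe_mk, Matrix.of_apply, h]
    split_ifs
    · simp
    · rfl
  · rintro ⟨h, ht⟩
    -- The witness is `σ = tr_O W / d_O ^ N`; its trace is then read off by cancelling `d_O ^ N`.
    have h' : ∀ x y, W x y = if (fun j => (x j).2) = (fun j => (y j).2) then
        (Matrix.of fun a b : Fin N → I => ((Fintype.card O : ℂ)⁻¹) ^ N * ∑ o : Fin N → O,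
          W (fun j => (a j, o j)) (fun j => (b j, o j)))
          (fun j => (x j).1) (fun j => (y j).1) else 0 := fun x y => by
      conv_lhs => rw [← h]
      rfl
    refine ⟨_, ?_, h'⟩
    have := trace_of_parallel W _ h'
    rw [ht] at this
    exact (mul_eq_left₀ (pow_ne_zero _ hO)).1 this.symm

/-! ### The condition for sequential strategies -/

/-- The map `A ↦ A ⊗ 1 / d_I` that adds a last slot. -/
def addSlot (N : ℕ) : Matrix (Fin N → I × O) (Fin N → I × O) ℂ →ₗ[ℂ]
    Matrix (Fin (N + 1) → I × O) (Fin (N + 1) → I × O) ℂ where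
  toFun A := Matrix.of fun x y => if x (Fin.last N) = y (Fin.last N) then
    (Fintype.card I : ℂ)⁻¹ * A (Fin.init x) (Fin.init y) else 0
  map_add' X Y := by
    ext x y
    simp only [Matrix.of_apply, Matrix.add_apply, mul_add]
    split_ifs <;> simp
  map_smul' c X := by
    ext x y
    simp only [Matrix.of_apply, Matrix.smul_apply, smul_eq_mul, RingHom.id_apply]
    split_ifs
    · ring
    · simp

/-- The map `W ↦ tr W / d_O`, the trace being over the last slot. -/
def traceSlot (N : ℕ) : Matrix (Fin (N + 1) → I × O) (Fin (N + 1) → I × O) ℂ →ₗ[ℂ]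
    Matrix (Fin N → I × O) (Fin N → I × O) ℂ where
  toFun W := Matrix.of fun x y => (Fintype.card O : ℂ)⁻¹ * ∑ p : I × O,
    W (Fin.snoc (α := fun _ => I × O) x p) (Fin.snoc (α := fun _ => I × O) y p)
  map_add' X Y := by
    ext x y
    simp only [Matrix.of_apply, Matrix.add_apply, Finset.sum_add_distrib, mul_add]
  map_smul' c X := by
    ext x y
    simp only [Matrix.of_apply, Matrix.smul_apply, smul_eq_mul, RingHom.id_apply,
      ← Finset.mul_sum]
    ring

theorem addSlot_apply {N : ℕ} (A : Matrix (Fin N → I × O) (Fin N → I × O) ℂ)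
    (x y : Fin (N + 1) → I × O) : addSlot N A x y = if x (Fin.last N) = y (Fin.last N) then
    (Fintype.card I : ℂ)⁻¹ * A (Fin.init x) (Fin.init y) else 0 := rfl

theorem traceSlot_apply {N : ℕ} (W : Matrix (Fin (N + 1) → I × O) (Fin (N + 1) → I × O) ℂ)
    (x y : Fin N → I × O) : traceSlot N W x y = (Fintype.card O : ℂ)⁻¹ * ∑ p : I × O,
    W (Fin.snoc (α := fun _ => I × O) x p) (Fin.snoc (α := fun _ => I × O) y p) := rfl

theorem addSlot_tensor {N : ℕ} (D : Fin N → Matrix (I × O) (I × O) ℂ) :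
    addSlot N (tensor D) = tensor (Fin.snoc (α := fun _ => Matrix (I × O) (I × O) ℂ) D
      ((Fintype.card I : ℂ)⁻¹ • 1)) := by
  ext x y
  simp only [addSlot_apply, tensor, Matrix.of_apply, Fin.prod_univ_castSucc, Fin.snoc_castSucc,
    Fin.snoc_last, Fin.init, Matrix.smul_apply, Matrix.one_apply, smul_eq_mul]
  split_ifs <;> simp [mul_comm]

theorem traceSlot_tensor {N : ℕ} (D : Fin (N + 1) → Matrix (I × O) (I × O) ℂ) :
    traceSlot N (tensor D) =
      ((Fintype.card O : ℂ)⁻¹ * (D (Fin.last N)).trace) • tensor (Fin.init D) := by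
  ext x y
  simp only [traceSlot_apply, tensor, Matrix.of_apply, Fin.prod_univ_castSucc, Fin.snoc_castSucc,
    Fin.snoc_last, Fin.init, Matrix.smul_apply, smul_eq_mul, ← Finset.mul_sum, Matrix.trace,
    Matrix.diag]
  ring

theorem addSlot_injective [Nonempty I] [Nonempty O] (N : ℕ) :
    Function.Injective (addSlot (I := I) (O := O) N) := by
  intro A B h
  ext x y
  obtain ⟨p⟩ : Nonempty (I × O) := inferInstance
  have := congrFun (congrFun h (Fin.snoc (α := fun _ => I × O) x p))
    (Fin.snoc (α := fun _ => I × O) y p)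
  simpa [addSlot_apply] using this

theorem tensor_smul_last {N : ℕ} (D : Fin N → Matrix (I × O) (I × O) ℂ)
    (A : Matrix (I × O) (I × O) ℂ) (c : ℂ) :
    tensor (Fin.snoc (α := fun _ => Matrix (I × O) (I × O) ℂ) D (c • A)) =
      c • tensor (Fin.snoc (α := fun _ => Matrix (I × O) (I × O) ℂ) D A) := by
  ext x y
  simp [tensor, Fin.prod_univ_castSucc]
  ring

/-- This factorization through one slot less drives the induction on combs. The factor `1 / d_O`
sits in `traceSlot` so that for `W = V ⊗ 1` the result is exactly the partial trace of `V` over the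
last input. -/
theorem replaceI_mul_replaceO_last {N : ℕ} :
    (replaceI (Fin.last N) * replaceO (Fin.last N) :
      Module.End ℂ (Matrix (Fin (N + 1) → I × O) (Fin (N + 1) → I × O) ℂ)) =
      addSlot N ∘ₗ traceSlot N := by
  refine linearMap_ext_tensor fun D => ?_
  rw [((actsOn_replaceI _).mul (actsOn_replaceO _)) D, LinearMap.comp_apply, traceSlot_tensor,
    map_smul, addSlot_tensor, Module.End.mul_apply, siteI_siteO, ← tensor_smul_last, smul_smul]
  congr 1
  conv_lhs => rw [← Fin.snoc_init_self D, Fin.update_snoc_last]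
  simp only [Fin.snoc_last]
  congr 2
  ring

/-- The endomorphism `T` of the operators with `N + 1` slots extends `S`. -/
def Extends {N : ℕ} (T : Module.End ℂ (Matrix (Fin (N + 1) → I × O) (Fin (N + 1) → I × O) ℂ))
    (S : Module.End ℂ (Matrix (Fin N → I × O) (Fin N → I × O) ℂ)) : Prop :=
  T ∘ₗ addSlot N = addSlot N ∘ₗ S

theorem ActsOn.extends {N : ℕ} {j : Fin N}
    {T : Module.End ℂ (Matrix (Fin (N + 1) → I × O) (Fin (N + 1) → I × O) ℂ)}
    {S : Module.End ℂ (Matrix (Fin N → I × O) (Fin N → I × O) ℂ)}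
    {t : Module.End ℂ (Matrix (I × O) (I × O) ℂ)}
    (hT : ActsOn j.castSucc T t) (hS : ActsOn j S t) : Extends T S := by
  refine linearMap_ext_tensor fun D => ?_
  rw [LinearMap.comp_apply, LinearMap.comp_apply, addSlot_tensor, hS, hT, addSlot_tensor,
    Fin.snoc_update, Fin.snoc_castSucc]

theorem Extends.mul {N : ℕ}
    {T T' : Module.End ℂ (Matrix (Fin (N + 1) → I × O) (Fin (N + 1) → I × O) ℂ)}
    {S S' : Module.End ℂ (Matrix (Fin N → I × O) (Fin N → I × O) ℂ)}
    (h : Extends T S) (h' : Extends T' S') : Extends (T * T') (S * S') := by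
  refine LinearMap.ext fun A => ?_
  have h1 := LinearMap.congr_fun h (S' A)
  have h2 := LinearMap.congr_fun h' A
  simp only [LinearMap.comp_apply, Module.End.mul_apply] at *
  rw [h2, h1]

theorem Extends.one {N : ℕ} : Extends (I := I) (O := O) (N := N) 1 1 := rfl

theorem Extends.list_prod {N : ℕ} {ι : Type*} (l : List ι)
    {T : ι → Module.End ℂ (Matrix (Fin (N + 1) → I × O) (Fin (N + 1) → I × O) ℂ)}
    {S : ι → Module.End ℂ (Matrix (Fin N → I × O) (Fin N → I × O) ℂ)}
    (h : ∀ i, Extends (T i) (S i)) : Extends (l.map T).prod (l.map S).prod := by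
  induction l with
  | nil => exact Extends.one
  | cons a l ih =>
    rw [List.map_cons, List.map_cons, List.prod_cons, List.prod_cons]
    exact (h a).mul ih

/-- The `j`-th term `(1 - O_j) ∏ l > j, I_l O_l` of the map for sequential strategies. -/
def seqTerm (N : ℕ) (j : Fin N) : Module.End ℂ (Matrix (Fin N → I × O) (Fin N → I × O) ℂ) :=
  (1 - replaceO j) *
    (((List.finRange N).filter fun l => j < l).map fun l => replaceI l * replaceO l).prod

theorem Lam_sequential_eq_iff {N : ℕ} (W : Matrix (Fin N → I × O) (Fin N → I × O) ℂ) :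
    Lam N .sequential W = W ↔ ∑ j, seqTerm N j W = 0 := by
  simp only [Lam]
  rw [LinearMap.sub_apply, Module.End.one_apply, sub_eq_self, LinearMap.sum_apply]
  rfl

theorem seqTerm_last (N : ℕ) :
    seqTerm (I := I) (O := O) (N + 1) (Fin.last N) = 1 - replaceO (Fin.last N) := by
  rw [seqTerm, List.filter_eq_nil_iff.2]
  · simp
  · intro a _
    simpa using Fin.le_last a

/-- For `j` before the last slot the product over `l > j` ends with `I O` of the last slot, that is
`addSlot ∘ traceSlot`; the other factors do not touch that slot and pass through `addSlot`. -/
theorem seqTerm_castSucc {N : ℕ} (j : Fin N) :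
    seqTerm (I := I) (O := O) (N + 1) j.castSucc =
      addSlot N ∘ₗ seqTerm N j ∘ₗ traceSlot N := by
  have h : ((List.finRange (N + 1)).filter fun l => j.castSucc < l) =
      (((List.finRange N).filter fun l => j < l).map Fin.castSucc) ++ [Fin.last N] := by
    rw [List.finRange_succ_last, List.filter_append, List.filter_map]
    congr 1
    simp [Fin.castSucc_lt_last]
  have h2 : Extends (I := I) (O := O) ((1 - replaceO j.castSucc) *
      (((List.finRange N).filter fun l => j < l).map fun l =>
        replaceI l.castSucc * replaceO l.castSucc).prod) (seqTerm N j) :=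
    ((ActsOn.one.sub (actsOn_replaceO j.castSucc)).extends
      (ActsOn.one.sub (actsOn_replaceO j))).mul (Extends.list_prod _ fun l =>
      ((actsOn_replaceI l.castSucc).mul (actsOn_replaceO _)).extends
        ((actsOn_replaceI l).mul (actsOn_replaceO _)))
  rw [seqTerm, h, List.map_append, List.prod_append, List.map_singleton, List.prod_singleton,
    replaceI_mul_replaceO_last, List.map_map, ← mul_assoc]
  refine LinearMap.ext fun W => ?_
  exact LinearMap.congr_fun h2 (traceSlot N W)

theorem replaceO_last_addSlot [Nonempty O] {N : ℕ} (A : Matrix (Fin N → I × O) (Fin N → I × O) ℂ) :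
    replaceO (Fin.last N) (addSlot N A) = addSlot N A := by
  ext x y
  simp only [replaceO_apply, addSlot_apply, Function.update_self, Prod.ext_iff]
  have h : ∀ (x : Fin (N + 1) → I × O) (p : I × O),
      Fin.init (Function.update x (Fin.last N) p) = Fin.init x := fun x p => by
    simp
  by_cases h1 : (x (Fin.last N)).1 = (y (Fin.last N)).1 <;>
    by_cases h2 : (x (Fin.last N)).2 = (y (Fin.last N)).2 <;> simp [h1, h2, h]

theorem replaceO_replaceO [Nonempty O] {N : ℕ} (j : Fin N)
    (W : Matrix (Fin N → I × O) (Fin N → I × O) ℂ) :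
    replaceO j (replaceO j W) = replaceO j W := by
  have h := (actsOn_replaceO (I := I) (O := O) j).mul (actsOn_replaceO j)
  rw [siteO_mul_siteO] at h
  exact LinearMap.congr_fun (h.eq (actsOn_replaceO j)) W

theorem Lam_sequential_succ_eq_iff [Nonempty I] [Nonempty O] {N : ℕ}
    (W : Matrix (Fin (N + 1) → I × O) (Fin (N + 1) → I × O) ℂ) :
    Lam (N + 1) .sequential W = W ↔
      replaceO (Fin.last N) W = W ∧ Lam N .sequential (traceSlot N W) = traceSlot N W := by
  rw [Lam_sequential_eq_iff, Lam_sequential_eq_iff, Fin.sum_univ_castSucc, seqTerm_last]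
  simp only [seqTerm_castSucc, LinearMap.comp_apply, ← map_sum]
  rw [LinearMap.sub_apply, Module.End.one_apply]
  constructor
  · intro h
    -- The sum of all terms is `(1 - O_last) W` plus an element of the range of `addSlot`. The
    -- idempotent `O_last` kills the former and fixes the latter, so both vanish separately.
    have h1 := congrArg (replaceO (Fin.last N)) h
    rw [map_add, map_sub, replaceO_replaceO, sub_self, add_zero, map_zero,
      replaceO_last_addSlot] at h1
    rw [h1, zero_add, sub_eq_zero] at h
    exact ⟨h.symm, addSlot_injective N (by rw [h1, map_zero])⟩
  · rintro ⟨h1, h2⟩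
    rw [h1, h2, map_zero, sub_self, add_zero]

/-- In `W = V ⊗ 1` the operator `V` is forced to be the normalized partial trace of `W` over the
last output. The predicate `T` stands for the remaining comb condition in the recursion. -/
theorem replaceO_last_eq_iff [Nonempty O] {N : ℕ}
    (W : Matrix (Fin (N + 1) → I × O) (Fin (N + 1) → I × O) ℂ)
    (T : Matrix (Fin N → I × O) (Fin N → I × O) ℂ → Prop) :
    (replaceO (Fin.last N) W = W ∧ T (traceSlot N W)) ↔
      ∃ V : Matrix ((Fin N → I × O) × I) ((Fin N → I × O) × I) ℂ,
        (∀ x y i i' o o', W (Fin.snoc x (i, o)) (Fin.snoc y (i', o')) =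
          if o = o' then V (x, i) (y, i') else 0) ∧ T (traceF V) := by
  have key : ∀ V : Matrix ((Fin N → I × O) × I) ((Fin N → I × O) × I) ℂ,
      (∀ x y i i' o o', W (Fin.snoc x (i, o)) (Fin.snoc y (i', o')) =
          if o = o' then V (x, i) (y, i') else 0) → traceF V = traceSlot N W := by
    intro V hV
    ext x y
    simp [traceF, traceSlot_apply, Fintype.sum_prod_type, hV, ← Finset.mul_sum]
  constructor
  · rintro ⟨h, hT⟩
    have hV : ∀ x y i i' o o', W (Fin.snoc x (i, o)) (Fin.snoc y (i', o')) =
        if o = o' then (Matrix.of fun a b : (Fin N → I × O) × I =>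
          (Fintype.card O : ℂ)⁻¹ * ∑ o, W (Fin.snoc (α := fun _ => I × O) a.1 (a.2, o))
            (Fin.snoc (α := fun _ => I × O) b.1 (b.2, o))) (x, i) (y, i') else 0 := by
      intro x y i i' o o'
      conv_lhs => rw [← h]
      simp [replaceO_apply, Fin.update_snoc_last]
    exact ⟨_, hV, by rwa [key _ hV]⟩
  · rintro ⟨V, hV, hT⟩
    refine ⟨?_, by rwa [← key V hV]⟩
    ext x y
    rw [← Fin.snoc_init_self x, ← Fin.snoc_init_self y]
    simp only [replaceO_apply, Fin.snoc_last, Fin.update_snoc_last]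
    have hV' : ∀ (x y : Fin N → I × O) (p r : I × O),
        W (Fin.snoc x p) (Fin.snoc y r) = if p.2 = r.2 then V (x, p.1) (y, r.1) else 0 :=
      fun x y p r => hV x y p.1 r.1 p.2 r.2
    rw [hV']
    simp [hV']

theorem trace_traceSlot [Nonempty O] {N : ℕ}
    (W : Matrix (Fin (N + 1) → I × O) (Fin (N + 1) → I × O) ℂ) :
    W.trace = Fintype.card O * (traceSlot N W).trace := by
  have : (Fintype.card O : ℂ) ≠ 0 := by simp
  simp only [Matrix.trace, Matrix.diag, traceSlot_apply, ← Finset.mul_sum]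
  rw [mul_inv_cancel_left₀ this, ← (Fin.snocEquiv fun _ => I × O).sum_comp, Fintype.sum_prod_type,
    Finset.sum_comm]
  rfl

theorem isComb_iff [Nonempty I] [Nonempty O] {N : ℕ}
    (W : Matrix (Fin N → I × O) (Fin N → I × O) ℂ) :
    IsComb N W ↔ Lam N .sequential W = W ∧ W.trace = (Fintype.card O : ℂ) ^ N := by
  induction N with
  | zero =>
    simp only [IsComb, Lam_sequential_eq_iff, Finset.univ_eq_empty, Finset.sum_empty, true_and,
      pow_zero]
    constructor
    · rintro rfl
      simp
    · intro h
      ext x y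
      rw [Subsingleton.elim y x, Matrix.one_apply_eq, ← h, Matrix.trace, Fintype.sum_unique,
        Matrix.diag, Subsingleton.elim x default]
  | succ N ih =>
    have hO : (Fintype.card O : ℂ) ≠ 0 := by simp
    rw [IsComb, ← replaceO_last_eq_iff W (IsComb N), ih, Lam_sequential_succ_eq_iff, and_assoc,
      trace_traceSlot, pow_succ', mul_right_inj' hO]

/-! ### Choi operators of channels -/

theorem vecMulVec_star_apply {n : Type*} (v : n → ℂ) (x y : n) :
    vecMulVec v (star v) x y = v x * star (v y) := rfl

theorem PosSemidef.exists_eq_mul_conjTranspose {n : Type*} [Fintype n] {M : Matrix n n ℂ}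
    (hM : M.PosSemidef) : ∃ (m : ℕ) (L : Matrix n (Fin m) ℂ), M = L * Lᴴ := by
  obtain ⟨m, v, hv⟩ := Matrix.posSemidef_iff_eq_sum_vecMulVec.1 hM
  refine ⟨m, Matrix.of fun x k => v k x, ?_⟩
  ext x y
  rw [hv, Matrix.sum_apply, Matrix.mul_apply]
  rfl

/-- Positive operators whose partial trace over the output is the identity. -/
def IsChoi (D : Matrix (I × O) (I × O) ℂ) : Prop := D.PosSemidef ∧ traceF D = 1

theorem IsChannel.isChoi {E : Matrix I I ℂ →ₗ[ℂ] Matrix O O ℂ} (hE : IsChannel E) :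
    IsChoi (choi E) := by
  constructor
  · let e := Fintype.equivFin I
    -- The unnormalized maximally entangled vector; the Choi operator is the image of its projector
    -- under `id ⊗ E`.
    let v : Fin (Fintype.card I) × I → ℂ := fun p => if p.1 = e p.2 then 1 else 0
    have h := (hE.completelyPositive _ _ (posSemidef_vecMulVec_self_star v)).submatrix
      (fun p : I × O => (e p.1, p.2))
    convert h using 1
    ext p r
    simp only [choi, ampliation, Matrix.of_apply, submatrix_apply]
    refine congrFun (congrFun (congrArg E ?_) _) _
    ext i j
    simp only [single_apply, Matrix.of_apply, vecMulVec_star_apply, v, EmbeddingLike.apply_eq_iff_eq]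
    by_cases h1 : p.1 = i <;> by_cases h2 : r.1 = j <;> simp [h1, h2]
  · ext i j
    have := hE.tracePreserving (single i j 1)
    simp only [traceF, choi, Matrix.of_apply]
    rw [Matrix.one_apply]
    refine this.trans ?_
    split_ifs with h
    · subst h
      exact trace_single_eq_same i 1
    · exact trace_single_eq_of_ne i j 1 h

/-- The linear map with a given Choi operator. -/
def ofChoi (D : Matrix (I × O) (I × O) ℂ) : Matrix I I ℂ →ₗ[ℂ] Matrix O O ℂ where
  toFun ρ := Matrix.of fun o o' => ∑ i, ∑ j, ρ i j * D (i, o) (j, o')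
  map_add' X Y := by
    ext x y
    simp [add_mul, Finset.sum_add_distrib]
  map_smul' c X := by
    ext x y
    simp [Finset.mul_sum, mul_assoc]

theorem choi_ofChoi (D : Matrix (I × O) (I × O) ℂ) : choi (ofChoi D) = D := by
  ext a b
  simp only [choi, ofChoi, Matrix.of_apply, LinearMap.coe_mk, AddHom.coe_mk, single_apply]
  rw [Finset.sum_eq_single a.1 (fun i _ hi => by simp [hi.symm]) (by simp),
    Finset.sum_eq_single b.1 (fun i _ hi => by simp [hi.symm]) (by simp)]
  simp

theorem IsChoi.isChannel {D : Matrix (I × O) (I × O) ℂ} (hD : IsChoi D) :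
    IsChannel (ofChoi D) where
  completelyPositive d M hM := by
    obtain ⟨m, L, rfl⟩ := PosSemidef.exists_eq_mul_conjTranspose hM
    obtain ⟨n, K, hK⟩ := PosSemidef.exists_eq_mul_conjTranspose hD.1
    -- Contracting the factors of `M` and `D` over the input index gives a factor of the output,
    -- whose positivity is then visible.
    let U : Matrix (Fin d × O) (Fin m × Fin n) ℂ :=
      Matrix.of fun a k => ∑ i, L (a.1, i) k.1 * K (i, a.2) k.2
    have : ampliation (ofChoi D) d (L * Lᴴ) = U * Uᴴ := by
      ext a b
      simp only [ampliation, ofChoi, Matrix.of_apply, LinearMap.coe_mk, AddHom.coe_mk, hK,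
        Matrix.mul_apply, U, Fintype.sum_prod_type, conjTranspose_apply, star_sum, star_mul',
        Finset.sum_mul_sum]
      rw [Finset.sum_congr rfl fun x _ => Finset.sum_comm, Finset.sum_comm]
      refine Finset.sum_congr rfl fun i _ => ?_
      rw [Finset.sum_congr rfl fun x _ => Finset.sum_comm, Finset.sum_comm]
      refine Finset.sum_congr rfl fun j _ => Finset.sum_congr rfl fun x _ =>
        Finset.sum_congr rfl fun y _ => ?_
      ring
    rw [this]
    exact posSemidef_self_mul_conjTranspose U
  tracePreserving ρ := by
    have h : ∀ i j, ∑ o, D (i, o) (j, o) = if i = j then 1 else 0 := fun i j => by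
      rw [← Matrix.one_apply, ← hD.2]; rfl
    simp only [ofChoi, LinearMap.coe_mk, AddHom.coe_mk, Matrix.trace, Matrix.diag, Matrix.of_apply]
    rw [Finset.sum_comm]
    refine Finset.sum_congr rfl fun i _ => ?_
    rw [Finset.sum_comm]
    simp [← Finset.mul_sum, h]

/-! ### Partial traces and the linear span of the Choi operators of channels. -/

theorem traceF_add {n F : Type*} [Fintype F] (A B : Matrix (n × F) (n × F) ℂ) :
    traceF (A + B) = traceF A + traceF B := by
  ext; simp [traceF, Finset.sum_add_distrib]

theorem traceF_smul {n F : Type*} [Fintype F] (c : ℂ) (A : Matrix (n × F) (n × F) ℂ) :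
    traceF (c • A) = c • traceF A := by
  ext; simp [traceF, Finset.mul_sum]

theorem traceF_one : traceF (1 : Matrix (I × O) (I × O) ℂ) = (Fintype.card O : ℂ) • 1 := by
  ext i j
  simp [traceF, Matrix.one_apply, Prod.ext_iff]

theorem traceF_conjTranspose {n F : Type*} [Fintype F] (A : Matrix (n × F) (n × F) ℂ) :
    traceF Aᴴ = (traceF A)ᴴ := by
  ext; simp [traceF]

theorem trace_traceF {n F : Type*} [Fintype n] [Fintype F] (A : Matrix (n × F) (n × F) ℂ) :
    (traceF A).trace = A.trace := by
  simp [Matrix.trace, traceF, Fintype.sum_prod_type]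

theorem isChoi_smul_one [Nonempty O] :
    IsChoi ((Fintype.card O : ℂ)⁻¹ • (1 : Matrix (I × O) (I × O) ℂ)) := by
  constructor
  · exact PosSemidef.one.smul (by simp)
  · rw [traceF_smul, traceF_one, smul_smul, inv_mul_cancel₀ (by simp), one_smul]

open scoped Matrix.Norms.L2Operator MatrixOrder in
theorem exists_posSemidef_add_smul_one {n : Type*} [Fintype n] [DecidableEq n] {A : Matrix n n ℂ}
    (hA : A.IsHermitian) (r : ℝ) : ∃ t : ℝ, r ≤ t ∧ 0 ≤ t ∧ (A + (t : ℂ) • 1).PosSemidef := by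
  have h1 : -algebraMap ℝ (Matrix n n ℂ) ‖A‖ ≤ A :=
    IsSelfAdjoint.neg_algebraMap_norm_le_self (a := A) hA
  refine ⟨‖A‖ + |r|, (le_abs_self r).trans (by linarith [norm_nonneg A]), by positivity, ?_⟩
  rw [Matrix.le_iff] at h1
  have h2 : A + ((‖A‖ + |r| : ℝ) : ℂ) • 1 =
      (A - -algebraMap ℝ (Matrix n n ℂ) ‖A‖) + ((|r| : ℝ) : ℂ) • 1 := by
    rw [sub_neg_eq_add, add_assoc]
    congr 1
    rw [Algebra.algebraMap_eq_smul_one]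
    ext i j
    simp [add_mul]
  rw [h2]
  exact h1.add (PosSemidef.one.smul (by simp))

/-- Adding a large multiple of the identity makes `B` positive without spoiling the scalar partial
trace. After rescaling, `B` is a combination of two Choi operators, one of them that of the
completely depolarizing channel. -/
theorem mem_span_of_isHermitian [Nonempty I] [Nonempty O] {B : Matrix (I × O) (I × O) ℂ}
    (hB : B.IsHermitian) {c : ℂ} (hc : traceF B = c • 1) :
    B ∈ Submodule.span ℂ {D : Matrix (I × O) (I × O) ℂ | IsChoi D} := by
  have hcr : (c.re : ℂ) = c := by
    have h := traceF_conjTranspose B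
    rw [hB.eq, hc] at h
    obtain ⟨i⟩ : Nonempty I := inferInstance
    have := congrFun (congrFun h i) i
    simp at this
    exact Complex.conj_eq_iff_re.1 this.symm
  -- Since `d_O ≥ 1`, the bound `t ≥ 1 + |c|` makes the new partial trace `c + t d_O` positive.
  obtain ⟨t, ht, ht0, hBt⟩ := exists_posSemidef_add_smul_one hB (1 + |c.re|)
  have hO : (1 : ℝ) ≤ Fintype.card O := by exact_mod_cast Fintype.card_pos
  have hs : 0 < c.re + t * Fintype.card O := by
    have := neg_abs_le c.re
    nlinarith
  have hs' : ((c.re + t * Fintype.card O : ℝ) : ℂ) ≠ 0 := by exact_mod_cast hs.ne'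
  have h1 : IsChoi (((c.re + t * Fintype.card O : ℝ) : ℂ)⁻¹ • (B + (t : ℂ) • 1)) := by
    constructor
    · refine hBt.smul ?_
      rw [← Complex.ofReal_inv]
      exact_mod_cast (inv_pos.2 hs).le
    · rw [traceF_smul, traceF_add, traceF_smul, traceF_one, hc, smul_smul, ← add_smul, smul_smul]
      have : c + t * Fintype.card O = ((c.re + t * Fintype.card O : ℝ) : ℂ) := by
        push_cast
        rw [hcr]
      rw [this, inv_mul_cancel₀ hs', one_smul]
  have h2 : B = ((c.re + t * Fintype.card O : ℝ) : ℂ) •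
      (((c.re + t * Fintype.card O : ℝ) : ℂ)⁻¹ • (B + (t : ℂ) • 1)) -
      (t * Fintype.card O : ℂ) • ((Fintype.card O : ℂ)⁻¹ • (1 : Matrix (I × O) (I × O) ℂ)) := by
    rw [smul_smul, mul_inv_cancel₀ hs', one_smul, smul_smul, mul_assoc,
      mul_inv_cancel₀ (by simp), mul_one, add_sub_cancel_right]
  rw [h2]
  exact Submodule.sub_mem _ (Submodule.smul_mem _ _ (Submodule.subset_span h1))
    (Submodule.smul_mem _ _ (Submodule.subset_span isChoi_smul_one))

/-- The Hermitian and anti-Hermitian parts of `B` again have scalar partial traces. -/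
theorem mem_span_of_traceF [Nonempty I] [Nonempty O] {B : Matrix (I × O) (I × O) ℂ} {c : ℂ}
    (hc : traceF B = c • 1) :
    B ∈ Submodule.span ℂ {D : Matrix (I × O) (I × O) ℂ | IsChoi D} := by
  have hc' : traceF Bᴴ = star c • 1 := by
    rw [traceF_conjTranspose, hc, conjTranspose_smul, conjTranspose_one]
  have h1 : (B + Bᴴ).IsHermitian := by simp [IsHermitian, add_comm]
  have h2 : (Complex.I • B + (-Complex.I) • Bᴴ).IsHermitian := by
    simp [IsHermitian, add_comm]
  have h : B = (1 / 2 : ℂ) • (B + Bᴴ) +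
      (-Complex.I / 2) • (Complex.I • B + (-Complex.I) • Bᴴ) := by
    ext a b
    simp only [Matrix.add_apply, Matrix.smul_apply, smul_eq_mul]
    linear_combination (Bᴴ a b / 2 - B a b / 2) * -Complex.I_mul_I
  rw [h]
  refine Submodule.add_mem _ (Submodule.smul_mem _ _ (mem_span_of_isHermitian h1 (c := c + star c)
    ?_)) (Submodule.smul_mem _ _ (mem_span_of_isHermitian h2
      (c := Complex.I * c + -Complex.I * star c) ?_))
  · rw [traceF_add, hc, hc', add_smul]
  · rw [traceF_add, traceF_smul, traceF_smul, hc, hc', smul_smul, smul_smul, add_smul]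

/-! ### The condition for general strategies -/

/-- The projection onto the span of the Choi operators of channels. -/
def siteP : Module.End ℂ (Matrix (I × O) (I × O) ℂ) := 1 - siteO + siteI * siteO

theorem siteO_eq_traceF (D : Matrix (I × O) (I × O) ℂ) (a b : I × O) : siteO D a b =
    if a.2 = b.2 then (Fintype.card O : ℂ)⁻¹ * traceF D a.1 b.1 else 0 := rfl

theorem siteP_apply (D : Matrix (I × O) (I × O) ℂ) : siteP D = D - siteO D +
    ((Fintype.card I : ℂ)⁻¹ * (Fintype.card O : ℂ)⁻¹ * D.trace) • 1 := by
  rw [← siteI_siteO]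
  rfl

theorem traceF_siteO [Nonempty O] (D : Matrix (I × O) (I × O) ℂ) :
    traceF (siteO D) = traceF D := by
  ext i j
  simp [traceF, siteO_apply]

/-- By `mem_span_of_traceF` the range of `siteP` therefore lies in the span of the Choi operators,
which `siteP` fixes by `IsChoi.siteP_eq`. -/
theorem traceF_siteP [Nonempty O] (D : Matrix (I × O) (I × O) ℂ) :
    traceF (siteP D) = ((Fintype.card I : ℂ)⁻¹ * D.trace) • 1 := by
  have hO : (Fintype.card O : ℂ) ≠ 0 := by simp
  have h : traceF (D - siteO D) = 0 := by
    rw [sub_eq_add_neg, ← neg_one_smul ℂ, traceF_add, traceF_smul, traceF_siteO]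
    simp
  rw [siteP_apply, traceF_add, h, zero_add, traceF_smul, traceF_one, smul_smul]
  congr 1
  field_simp

theorem trace_siteP [Nonempty I] [Nonempty O] (D : Matrix (I × O) (I × O) ℂ) :
    (siteP D).trace = D.trace := by
  have hI : (Fintype.card I : ℂ) ≠ 0 := by simp
  rw [← trace_traceF, traceF_siteP, trace_smul, trace_one, smul_eq_mul]
  field_simp

theorem IsChoi.trace {D : Matrix (I × O) (I × O) ℂ} (hD : IsChoi D) :
    D.trace = Fintype.card I := by
  rw [← trace_traceF, hD.2, trace_one]

theorem IsChoi.siteP_eq [Nonempty I] {D : Matrix (I × O) (I × O) ℂ} (hD : IsChoi D) :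
    siteP D = D := by
  have h : siteO D = (Fintype.card O : ℂ)⁻¹ • 1 := by
    ext a b
    rw [siteO_eq_traceF, hD.2]
    by_cases h1 : a.1 = b.1 <;> by_cases h2 : a.2 = b.2 <;> simp [Matrix.one_apply, h1, h2,
      Prod.ext_iff]
  have hI : (Fintype.card I : ℂ) ≠ 0 := by simp
  rw [siteP_apply, h, hD.trace, mul_right_comm, inv_mul_cancel₀ hI, one_mul, sub_add_cancel]

/-- The bilinear pairing `tr (W Aᵀ)`, as a linear form in `W`. -/
def pairing {n : Type*} [Fintype n] (A : Matrix n n ℂ) : Matrix n n ℂ →ₗ[ℂ] ℂ where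
  toFun W := ∑ x, ∑ y, W x y * A x y
  map_add' X Y := by simp [add_mul, Finset.sum_add_distrib]
  map_smul' c X := by simp [Finset.mul_sum, mul_assoc]

theorem pairing_apply {n : Type*} [Fintype n] (A W : Matrix n n ℂ) :
    pairing A W = ∑ x, ∑ y, W x y * A x y := rfl

theorem pairing_comm {n : Type*} [Fintype n] (A W : Matrix n n ℂ) :
    pairing A W = pairing W A := by simp only [pairing_apply, mul_comm]

theorem pairing_one {n : Type*} [Fintype n] [DecidableEq n] (A : Matrix n n ℂ) :
    pairing A 1 = A.trace := by
  simp [pairing_apply, Matrix.one_apply, Matrix.trace]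

theorem pairing_siteO (A B : Matrix (I × O) (I × O) ℂ) :
    pairing B (siteO A) = (Fintype.card O : ℂ)⁻¹ * pairing (traceF B) (traceF A) := by
  simp only [pairing_apply, siteO_eq_traceF, Fintype.sum_prod_type, ite_mul, zero_mul,
    Finset.sum_ite_eq, Finset.mem_univ, if_true, Finset.mul_sum]
  refine Finset.sum_congr rfl fun i _ => ?_
  rw [Finset.sum_comm]
  refine Finset.sum_congr rfl fun j _ => ?_
  rw [← Finset.mul_sum, mul_assoc]
  rfl

theorem pairing_siteP (A B : Matrix (I × O) (I × O) ℂ) :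
    pairing B (siteP A) = pairing (siteP B) A := by
  rw [pairing_comm (siteP B), siteP_apply, siteP_apply, map_add, map_sub, map_add, map_sub,
    map_smul, map_smul, pairing_one, pairing_one, pairing_siteO, pairing_siteO,
    pairing_comm A B, pairing_comm (traceF A), smul_eq_mul, smul_eq_mul]
  ring

theorem pairing_tensor {N : ℕ} (A B : Fin N → Matrix (I × O) (I × O) ℂ) :
    pairing (tensor B) (tensor A) = ∏ j, pairing (B j) (A j) := by
  simp only [pairing_apply, tensor, Matrix.of_apply]
  rw [Finset.prod_univ_sum, Fintype.piFinset_univ]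
  refine Finset.sum_congr rfl fun x _ => ?_
  rw [Finset.prod_univ_sum, Fintype.piFinset_univ]
  simp only [Finset.prod_mul_distrib]

theorem eq_of_pairing_tensor {N : ℕ} {Z Z' : Matrix (Fin N → I × O) (Fin N → I × O) ℂ}
    (h : ∀ D : Fin N → Matrix (I × O) (I × O) ℂ, pairing (tensor D) Z = pairing (tensor D) Z') :
    Z = Z' := by
  have key : ∀ (Z : Matrix (Fin N → I × O) (Fin N → I × O) ℂ) (x y : Fin N → I × O),
      pairing (single x y 1) Z = Z x y := fun Z x y => by
    rw [pairing_apply, Finset.sum_eq_single x (fun i _ hi => by simp [hi.symm])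
      (by simp), Finset.sum_eq_single y (fun i _ hi => by simp [hi.symm]) (by simp)]
    simp
  ext x y
  rw [← key Z, ← key Z', single_eq_tensor, h]

/-- The product of the maps `I_j O_j`. -/
def replaceAll (N : ℕ) : Module.End ℂ (Matrix (Fin N → I × O) (Fin N → I × O) ℂ) :=
  ((List.finRange N).map fun j => replaceI j * replaceO j).prod

/-- The product of the maps `1 - O_j + I_j O_j`. -/
def projectAll (N : ℕ) : Module.End ℂ (Matrix (Fin N → I × O) (Fin N → I × O) ℂ) :=
  ((List.finRange N).map fun j => 1 - replaceO j + replaceI j * replaceO j).prod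

theorem replaceAll_apply {N : ℕ} (W : Matrix (Fin N → I × O) (Fin N → I × O) ℂ) :
    replaceAll N W =
      (((Fintype.card I : ℂ)⁻¹ * (Fintype.card O : ℂ)⁻¹) ^ N * W.trace) • 1 := by
  have : replaceAll N =
      (LinearMap.toSpanSingleton ℂ (Matrix (Fin N → I × O) (Fin N → I × O) ℂ) 1) ∘ₗ
      ((((Fintype.card I : ℂ)⁻¹ * (Fintype.card O : ℂ)⁻¹) ^ N) •
        Matrix.traceLinearMap (Fin N → I × O) ℂ ℂ) := by
    refine linearMap_ext_tensor fun D => ?_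
    rw [replaceAll, ActsOn.list_prod_finRange fun j => (actsOn_replaceI j).mul (actsOn_replaceO j)]
    simp only [Module.End.mul_apply, siteI_siteO, LinearMap.comp_apply,
      LinearMap.toSpanSingleton_apply, LinearMap.smul_apply, traceLinearMap_apply, trace_tensor]
    ext x y
    simp only [tensor, Matrix.of_apply, Matrix.smul_apply, Matrix.one_apply, smul_eq_mul,
      Finset.prod_mul_distrib, Finset.prod_const, Finset.card_univ, Fintype.card_fin]
    rw [Finset.prod_ite_zero]
    simp [funext_iff, mul_pow]
  rw [this]
  rfl

theorem pairing_prod_siteP {N : ℕ} (W : Matrix (Fin N → I × O) (Fin N → I × O) ℂ)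
    (D : Fin N → Matrix (I × O) (I × O) ℂ) :
    pairing (tensor D) (projectAll N W) =
      pairing (tensor fun j => siteP (D j)) W := by
  rw [← LinearMap.comp_apply]
  refine LinearMap.congr_fun (linearMap_ext_tensor fun A => ?_) W
  rw [LinearMap.comp_apply, projectAll, ActsOn.list_prod_finRange (s := siteP) fun j =>
    (ActsOn.one.sub (actsOn_replaceO j)).add ((actsOn_replaceI j).mul (actsOn_replaceO j)),
    pairing_tensor, pairing_tensor]
  simp only [pairing_siteP]

/-- The tensor product as a linear map of its `j`-th factor. -/
def tensorLinear {N : ℕ} (D : Fin N → Matrix (I × O) (I × O) ℂ) (j : Fin N) :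
    Matrix (I × O) (I × O) ℂ →ₗ[ℂ] Matrix (Fin N → I × O) (Fin N → I × O) ℂ where
  toFun A := tensor (Function.update D j A)
  map_add' X Y := by
    ext x y
    simp only [tensor_update, Matrix.add_apply, add_mul]
  map_smul' c X := by
    ext x y
    simp only [tensor_update, Matrix.smul_apply, smul_eq_mul, mul_assoc, RingHom.id_apply]

/-- On Choi operators the functional `D ↦ tr D / d_I` equals `1`, so both sides agree on products of
Choi operators, and multilinearity extends this to their span. -/
theorem pairing_tensor_of_mem_span [Nonempty I] {N : ℕ}
    {W : Matrix (Fin N → I × O) (Fin N → I × O) ℂ}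
    (hW : ∀ D : Fin N → Matrix (I × O) (I × O) ℂ, (∀ j, IsChoi (D j)) → pairing (tensor D) W = 1)
    (D : Fin N → Matrix (I × O) (I × O) ℂ)
    (hD : ∀ j, D j ∈ Submodule.span ℂ {D : Matrix (I × O) (I × O) ℂ | IsChoi D}) :
    pairing (tensor D) W = ∏ j, (Fintype.card I : ℂ)⁻¹ * (D j).trace := by
  have hI : (Fintype.card I : ℂ) ≠ 0 := by simp
  -- Slots are released one at a time: `s` contains those where `D j` is only known to lie in the
  -- span.
  suffices h : ∀ (s : Finset (Fin N)) (D : Fin N → Matrix (I × O) (I × O) ℂ),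
      (∀ j ∉ s, IsChoi (D j)) →
      (∀ j, D j ∈ Submodule.span ℂ {D : Matrix (I × O) (I × O) ℂ | IsChoi D}) →
      pairing (tensor D) W = ∏ j, (Fintype.card I : ℂ)⁻¹ * (D j).trace from
    h Finset.univ D (by simp) hD
  intro s
  induction s using Finset.induction_on with
  | empty =>
    intro D hD _
    rw [hW D fun j => hD j (by simp)]
    exact (Finset.prod_eq_one fun j _ => by
      rw [(hD j (by simp)).trace, inv_mul_cancel₀ hI]).symm
  | insert a s ha ih =>
    intro D hD hspan
    let c := ∏ k ∈ Finset.univ.erase a, (Fintype.card I : ℂ)⁻¹ * (D k).trace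
    have hlin : Set.EqOn ((pairing W) ∘ₗ tensorLinear D a)
        ((c * (Fintype.card I : ℂ)⁻¹) • Matrix.traceLinearMap (I × O) ℂ ℂ :
          Matrix (I × O) (I × O) ℂ →ₗ[ℂ] ℂ)
        {D : Matrix (I × O) (I × O) ℂ | IsChoi D} := by
      intro A hA
      have hs : ∀ j, Function.update D a A j ∈
          Submodule.span ℂ {D : Matrix (I × O) (I × O) ℂ | IsChoi D} := fun j => by
        by_cases hj : j = a
        · subst hj
          simpa using Submodule.subset_span hA
        · simpa [hj] using hspan j
      have hc : ∀ j ∉ s, IsChoi (Function.update D a A j) := fun j hjs => by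
        by_cases hj : j = a
        · subst hj
          simpa using hA
        · simpa [hj] using hD j (by simp [hj, hjs])
      have := ih _ hc hs
      rw [LinearMap.comp_apply, pairing_comm]
      refine this.trans ?_
      rw [← Finset.mul_prod_erase _ _ (Finset.mem_univ a), Function.update_self,
        LinearMap.smul_apply, traceLinearMap_apply, smul_eq_mul]
      rw [Finset.prod_congr rfl (g := fun k => (Fintype.card I : ℂ)⁻¹ * (D k).trace)
        fun k hk => by rw [Function.update_of_ne (Finset.ne_of_mem_erase hk)]]
      simp only [c]
      ring
    have h := LinearMap.eqOn_span hlin (hspan a)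
    rw [LinearMap.comp_apply, pairing_comm, LinearMap.smul_apply, traceLinearMap_apply,
      smul_eq_mul] at h
    change pairing (tensor (Function.update D a (D a))) W = _ at h
    rw [Function.update_eq_self] at h
    rw [h, ← Finset.mul_prod_erase _ _ (Finset.mem_univ a)]
    simp only [c]
    ring

theorem tensor_smul_one {N : ℕ} (c : ℂ) :
    tensor (fun _ : Fin N => c • (1 : Matrix (I × O) (I × O) ℂ)) = c ^ N • 1 := by
  ext x y
  simp only [tensor, Matrix.of_apply, Matrix.smul_apply, Matrix.one_apply, smul_eq_mul,
    Finset.prod_mul_distrib, Finset.prod_const, Finset.card_univ, Fintype.card_fin]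
  rw [Finset.prod_ite_zero]
  simp [funext_iff]

/-- The fixed-point equation says that `projectAll` sends `W` to a multiple of the identity. As
`siteP` is symmetric for the pairing, testing this against products moves the projection onto the
test operators, where only the span of Choi operators matters. -/
theorem indefinite_iff [Nonempty I] [Nonempty O] {N : ℕ}
    (W : Matrix (Fin N → I × O) (Fin N → I × O) ℂ) :
    (∀ D : Fin N → Matrix (I × O) (I × O) ℂ, (∀ j, IsChoi (D j)) → pairing (tensor D) W = 1) ↔
      Lam N .indefinite W = W ∧ W.trace = (Fintype.card O : ℂ) ^ N := by
  have hI : (Fintype.card I : ℂ) ≠ 0 := by simp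
  have hO : (Fintype.card O : ℂ) ≠ 0 := by simp
  have hL : Lam N .indefinite W = W ↔
      projectAll N W =
      (((Fintype.card I : ℂ)⁻¹ * (Fintype.card O : ℂ)⁻¹) ^ N * W.trace) • 1 := by
    change (1 - projectAll N + replaceAll N : Module.End ℂ _) W = W ↔ _
    rw [LinearMap.add_apply, LinearMap.sub_apply, replaceAll_apply, Module.End.one_apply,
      sub_add_eq_add_sub, sub_eq_iff_eq_add, add_right_inj, eq_comm]
  rw [hL]
  constructor
  · intro h
    have ht : W.trace = (Fintype.card O : ℂ) ^ N := by
      -- Inserting completely depolarizing channels determines the trace.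
      have := h (fun _ => (Fintype.card O : ℂ)⁻¹ • 1) fun _ => isChoi_smul_one
      rw [tensor_smul_one, pairing_comm, map_smul, pairing_one, smul_eq_mul, inv_pow] at this
      exact (inv_mul_eq_one₀ (pow_ne_zero _ hO)).1 this |>.symm
    refine ⟨eq_of_pairing_tensor fun D => ?_, ht⟩
    rw [pairing_prod_siteP, pairing_tensor_of_mem_span h _ fun j => mem_span_of_traceF
      (traceF_siteP _), ht, map_smul, pairing_one, trace_tensor, ← mul_pow, mul_assoc,
      inv_mul_cancel₀ hO, mul_one, smul_eq_mul, Finset.prod_mul_distrib]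
    simp [trace_siteP]
  · rintro ⟨h, ht⟩ D hD
    have h1 : tensor D = tensor fun j => siteP (D j) := by
      congr 1
      funext j
      exact (hD j).siteP_eq.symm
    rw [h1, ← pairing_prod_siteP, h, ht, map_smul, pairing_one, trace_tensor, ← mul_pow, mul_assoc,
      inv_mul_cancel₀ hO, mul_one, smul_eq_mul]
    simp [fun j => (hD j).trace]

/-! ### Least squares over Hermitian matrices -/

section LeastSquares

variable {m p : Type*} [Fintype m] [Fintype p]

theorem trace_mul_conjTranspose_re_nonneg (M : Matrix m p ℂ) : 0 ≤ (M * Mᴴ).trace.re :=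
  (Complex.le_def.1 (posSemidef_self_mul_conjTranspose M).trace_nonneg).1

theorem eq_zero_of_trace_mul_conjTranspose_re {M : Matrix m p ℂ} (h : (M * Mᴴ).trace.re ≤ 0) :
    M = 0 := by
  have h0 := Complex.le_def.1 (posSemidef_self_mul_conjTranspose M).trace_nonneg
  exact trace_mul_conjTranspose_self_eq_zero_iff.1
    (Complex.ext (le_antisymm h h0.1) h0.2.symm)

theorem trace_mul_im_eq_zero {A B : Matrix p p ℂ} (hA : A.IsHermitian) (hB : B.IsHermitian) :
    (A * B).trace.im = 0 := by
  have h : star (A * B).trace = (A * B).trace := by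
    rw [← trace_conjTranspose, conjTranspose_mul, hA.eq, hB.eq, trace_mul_comm]
  exact Complex.conj_eq_iff_im.1 h

/-- The test matrix `h = i (Y - Y†)` already gives `‖Y - Y†‖² = 0`. -/
theorem isHermitian_of_forall_trace_mul_im {Y : Matrix p p ℂ}
    (hY : ∀ h : Matrix p p ℂ, h.IsHermitian → (h * Y).trace.im = 0) : Y.IsHermitian := by
  have hD : (Y - Yᴴ)ᴴ = -(Y - Yᴴ) := by simp
  have hh : (Complex.I • (Y - Yᴴ)).IsHermitian := by
    rw [IsHermitian, conjTranspose_smul, hD, smul_neg, ← neg_smul]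
    simp
  have h1 := hY _ hh
  have h2 := trace_mul_im_eq_zero hh (isHermitian_add_transpose_self Y)
  rw [smul_mul_assoc, trace_smul, smul_eq_mul, Complex.I_mul_im] at h1 h2
  have h3 : (Y - Yᴴ) * (Y - Yᴴ)ᴴ = (Y - Yᴴ) * (Y + Yᴴ) - (2 : ℂ) • ((Y - Yᴴ) * Y) := by
    rw [hD, Matrix.mul_neg, Matrix.mul_sub, Matrix.mul_add, two_smul]
    abel
  have h5 : Y - Yᴴ = 0 := eq_zero_of_trace_mul_conjTranspose_re (by
    rw [h3, trace_sub, trace_smul, Complex.sub_re, h2, smul_eq_mul, Complex.mul_re, h1]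
    simp)
  exact (sub_eq_zero.1 h5).symm

/-- A matrix as a vector of a Euclidean space. -/
def toVec : Matrix m p ℂ →ₗ[ℝ] EuclideanSpace ℂ (m × p) where
  toFun A := WithLp.toLp 2 fun a => A a.1 a.2
  map_add' _ _ := rfl
  map_smul' _ _ := rfl

theorem toVec_apply (A : Matrix m p ℂ) (a : m × p) : toVec A a = A a.1 a.2 := rfl

theorem inner_toVec (A B : Matrix m p ℂ) : inner ℝ (toVec A) (toVec B) = (Aᴴ * B).trace.re := by
  rw [PiLp.inner_apply, Fintype.sum_prod_type_right]
  simp [toVec_apply, Matrix.trace, Matrix.mul_apply, Complex.inner, mul_comm]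

/-- Orthogonal projection onto the range of `T`. The inner product is the real one, `Re tr (A† B)`,
because Hermitian matrices form only a real vector space. -/
theorem exists_least_squares {V : Type*} [AddCommGroup V] [Module ℝ V]
    (T : V →ₗ[ℝ] Matrix m p ℂ) (A : Matrix m p ℂ) :
    ∃ v, ∀ v', ((T v')ᴴ * (A - T v)).trace.re = 0 := by
  let K := LinearMap.range (toVec ∘ₗ T)
  obtain ⟨v, hv⟩ : K.starProjection (toVec A) ∈ K := Submodule.starProjection_apply_mem K _
  refine ⟨v, fun v' => ?_⟩
  have h := K.starProjection_inner_eq_zero (toVec A) (toVec (T v')) ⟨v', rfl⟩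
  rw [← hv, LinearMap.comp_apply, ← map_sub, real_inner_comm, inner_toVec] at h
  exact h

/-- These are the normal equations for minimizing `‖A + i G h‖` over Hermitian `h`: the residual `K`
is orthogonal to all `i G h'` iff `tr (h' G† K)` is always real. -/
theorem exists_isHermitian_mul (G A : Matrix m p ℂ) :
    ∃ h : Matrix p p ℂ, h.IsHermitian ∧ (Gᴴ * (A + Complex.I • (G * h))).IsHermitian := by
  let T : selfAdjoint.submodule ℝ (Matrix p p ℂ) →ₗ[ℝ] Matrix m p ℂ :=
    { toFun := fun h => -(Complex.I • (G * (h : Matrix p p ℂ)))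
      map_add' := fun x y => by
        simp only [Submodule.coe_add, Matrix.mul_add, smul_add, neg_add]
      map_smul' := fun c x => by
        simp only [SetLike.val_smul, Matrix.mul_smul, RingHom.id_apply, smul_neg]
        rw [smul_comm] }
  obtain ⟨h, hh⟩ := exists_least_squares T A
  refine ⟨h, h.2, isHermitian_of_forall_trace_mul_im fun h' hh' => ?_⟩
  have h2 := hh ⟨h', hh'⟩
  simp only [T, LinearMap.coe_mk, AddHom.coe_mk, sub_neg_eq_add, conjTranspose_neg,
    conjTranspose_smul, conjTranspose_mul, hh'.eq] at h2
  rw [← Matrix.mul_assoc]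
  simpa using h2

/-- Pythagoras: the residual at `h` is orthogonal to `i G (h' - h)`. -/
theorem trace_le_of_isHermitian {G A : Matrix m p ℂ} {h : Matrix p p ℂ} (hh : h.IsHermitian)
    (hK : (Gᴴ * (A + Complex.I • (G * h))).IsHermitian) {h' : Matrix p p ℂ}
    (hh' : h'.IsHermitian) :
    ((A + Complex.I • (G * h)) * (A + Complex.I • (G * h))ᴴ).trace.re ≤
      ((A + Complex.I • (G * h')) * (A + Complex.I • (G * h'))ᴴ).trace.re := by
  set K := A + Complex.I • (G * h) with hKdef
  set M := Complex.I • (G * (h' - h))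
  have h1 : A + Complex.I • (G * h') = K + M := by
    simp only [K, M, Matrix.mul_sub, smul_sub]
    abel
  have h2 : (K * Mᴴ).trace = -Complex.I * ((h' - h) * (Gᴴ * K)).trace := by
    simp only [M, conjTranspose_smul, conjTranspose_mul, (hh'.sub hh).eq, Matrix.mul_smul,
      trace_smul]
    rw [trace_mul_comm, Matrix.mul_assoc]
    simp
  have h3 : (K * Mᴴ).trace.re = 0 := by
    rw [h2]
    simp [trace_mul_im_eq_zero (hh'.sub hh) hK]
  have h4 : (M * Kᴴ).trace.re = 0 := by
    rw [← h3, ← Complex.conj_re, ← Complex.star_def, ← trace_conjTranspose, conjTranspose_mul,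
      conjTranspose_conjTranspose]
  have h5 : ((K + M) * (K + M)ᴴ).trace.re = (K * Kᴴ).trace.re + (M * Mᴴ).trace.re := by
    rw [conjTranspose_add, Matrix.add_mul, Matrix.mul_add, Matrix.mul_add, trace_add, trace_add,
      trace_add, Complex.add_re, Complex.add_re, Complex.add_re, h3, h4]
    ring
  rw [h1, h5]
  linarith [trace_mul_conjTranspose_re_nonneg M]

/-- If the range of `K` lies in that of `G`, and `Gᴴ K` is Hermitian, then `-2 K = S G` for a
Hermitian `S`. -/
theorem exists_isHermitian_mul_eq {G K : Matrix m p ℂ} (hK : (Gᴴ * K).IsHermitian)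
    (hGK : ∀ U : Matrix p m ℂ, U * G = 0 → U * K = 0) :
    ∃ S : Matrix m m ℂ, S.IsHermitian ∧ S * G = -((2 : ℂ) • K) := by
  -- `S` is the least-squares solution of `S G = -2 K`, taken through adjoints; the rest shows that
  -- its residual `R` vanishes. The normal equations say that `R G†` is anti-Hermitian.
  obtain ⟨S, hS, h⟩ := exists_isHermitian_mul Gᴴ ((2 * Complex.I) • Kᴴ)
  refine ⟨S, hS, ?_⟩
  set R := (2 : ℂ) • K + S * G with hR
  have hRc : (2 * Complex.I) • Kᴴ + Complex.I • (Gᴴ * S) = Complex.I • Rᴴ := by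
    rw [hR, conjTranspose_add, conjTranspose_smul, conjTranspose_mul, hS.eq, smul_add, smul_smul,
      mul_comm]
    simp
  rw [hRc, conjTranspose_conjTranspose, Matrix.mul_smul, IsHermitian, conjTranspose_smul,
    conjTranspose_mul, conjTranspose_conjTranspose, Complex.star_def, Complex.conj_I, neg_smul,
    ← smul_neg] at h
  have h1 : G * Rᴴ = -(R * Gᴴ) := (smul_right_injective _ Complex.I_ne_zero h).symm
  have h2 : Rᴴ * G = Gᴴ * R := by
    have : (Gᴴ * R).IsHermitian := by
      rw [hR, Matrix.mul_add, Matrix.mul_smul, ← Matrix.mul_assoc]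
      refine IsHermitian.add ?_ (isHermitian_conjTranspose_mul_mul G hS)
      rw [IsHermitian, conjTranspose_smul, hK.eq]
      simp
    rw [← this.eq, conjTranspose_mul, conjTranspose_conjTranspose]
  -- With `R G†` anti-Hermitian and `G† R` Hermitian, cyclicity gives `‖R G†‖² = -‖G† R‖²`, so both
  -- vanish.
  have h3 : ((R * Gᴴ) * (R * Gᴴ)ᴴ).trace = -((Gᴴ * R) * (Gᴴ * R)ᴴ).trace := by
    rw [conjTranspose_mul, conjTranspose_conjTranspose, h1, Matrix.mul_neg, trace_neg,
      conjTranspose_mul, conjTranspose_conjTranspose, h2, ← Matrix.mul_assoc, trace_mul_comm]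
    simp only [Matrix.mul_assoc]
  have h4 : R * Gᴴ = 0 := eq_zero_of_trace_mul_conjTranspose_re (by
    rw [h3, Complex.neg_re]
    linarith [trace_mul_conjTranspose_re_nonneg (Gᴴ * R)])
  have h5 : Gᴴ * R = 0 := eq_zero_of_trace_mul_conjTranspose_re (by
    have h3' := congrArg Complex.re h3
    rw [h4, Complex.neg_re] at h3'
    simp at h3' ⊢
    linarith)
  have h6 : Rᴴ * K = 0 := hGK _ (h2.trans h5)
  have h7 : (R * Rᴴ).trace = 0 := by
    rw [trace_mul_comm]
    nth_rewrite 2 [hR]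
    rw [Matrix.mul_add, Matrix.mul_smul, h6, smul_zero, zero_add, trace_mul_comm, Matrix.mul_assoc,
      h1, h4]
    simp
  have h8 : R = 0 := eq_zero_of_trace_mul_conjTranspose_re (by rw [h7]; simp)
  exact eq_neg_of_add_eq_zero_right h8

end LeastSquares

/-! ### The information gained by a strategy -/

section Information

variable {n : Type*} [Fintype n] {q : ℕ}

theorem conj_mul {l m n : Type*} [Fintype m] (A : Matrix l m ℂ) (B : Matrix m n ℂ) :
    conj (A * B) = conj A * conj B := Matrix.map_mul

theorem conj_conj {m n : Type*} (A : Matrix m n ℂ) : conj (conj A) = A := by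
  ext
  simp [conj]

theorem conj_conjTranspose {m n : Type*} (A : Matrix m n ℂ) : conj Aᴴ = (conj A)ᴴ := rfl

theorem conj_transpose {m n : Type*} (A : Matrix m n ℂ) : conj Aᵀ = Aᴴ := rfl

theorem conj_add {m n : Type*} (A B : Matrix m n ℂ) : conj (A + B) = conj A + conj B := by
  ext
  simp [conj]

theorem conj_smul {m n : Type*} (c : ℂ) (A : Matrix m n ℂ) :
    conj (c • A) = star c • conj A := by
  ext
  simp [conj]

theorem isHermitian_conj {A : Matrix n n ℂ} (hA : A.IsHermitian) : (conj A).IsHermitian := by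
  rw [IsHermitian, ← conj_conjTranspose, hA.eq]

theorem trace_conj_re (A : Matrix n n ℂ) : (conj A).trace.re = A.trace.re := by
  simp [conj, Matrix.trace]

variable {H : Matrix n n ℂ} {Φ : Matrix n (Fin q) ℂ}

/-- Complex conjugation preserves the real part of a trace and removes the conjugates from `Ω`; the
price is `conj h`, which is harmless as `h` ranges over all Hermitian matrices. -/
theorem trace_mul_Omega {m : Type*} [Fintype m] (L : Matrix n m ℂ) (h : Matrix (Fin q) (Fin q) ℂ) :
    (L * Lᴴ * Omega H Φ h).trace.re =
      4 * ((Lᵀ * (H * Φ) + Complex.I • (Lᵀ * Φ * conj h)) *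
        (Lᵀ * (H * Φ) + Complex.I • (Lᵀ * Φ * conj h))ᴴ).trace.re := by
  have h1 : conj (Lᵀ * (H * Φ) + Complex.I • (Lᵀ * Φ * conj h)) =
      Lᴴ * (conj H * conj Φ - Complex.I • (conj Φ * h)) := by
    simp only [conj_add, conj_smul, conj_mul, conj_conj, conj_transpose, Matrix.mul_sub,
      Matrix.mul_smul, Matrix.mul_assoc]
    simp [sub_eq_add_neg]
  rw [← trace_conj_re ((_ + _) * _), conj_mul, conj_conjTranspose, h1, Omega, Matrix.mul_smul, trace_smul,
    conjTranspose_mul, conjTranspose_conjTranspose, Matrix.mul_assoc, trace_mul_comm]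
  simp [Matrix.mul_assoc]

/-- The columns of `L`, reshaped to matrices, act as Kraus operators. `traceF_eq_sum` uses the same
ones, so output states and `tr (W Ω(h))` become comparable. -/
theorem link_eq_sum {F : Type*} [Fintype F] {m : ℕ} (L : Matrix (n × F) (Fin m) ℂ)
    (A : Matrix n n ℂ) : link (L * Lᴴ) A =
      ∑ k, (Matrix.of fun x f => L (x, f) k)ᵀ * A * conj (Matrix.of fun x f => L (x, f) k) := by
  ext f g
  simp only [link, Matrix.of_apply, Matrix.mul_apply, Matrix.sum_apply, conj, Matrix.map_apply,
    transpose_apply, conjTranspose_apply, Finset.sum_mul]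
  rw [Finset.sum_congr rfl fun x _ => Finset.sum_comm, Finset.sum_comm]
  refine Finset.sum_congr rfl fun k _ => ?_
  rw [Finset.sum_comm]
  refine Finset.sum_congr rfl fun y _ => Finset.sum_congr rfl fun x _ => ?_
  rw [mul_right_comm]
  rfl

theorem traceF_eq_sum {F : Type*} [Fintype F] {m : ℕ} (L : Matrix (n × F) (Fin m) ℂ) :
    traceF (L * Lᴴ) =
      ∑ k, (Matrix.of fun x f => L (x, f) k) * (Matrix.of fun x f => L (x, f) k)ᴴ := by
  ext x y
  simp only [traceF, Matrix.of_apply, Matrix.mul_apply, Matrix.sum_apply, conjTranspose_apply]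
  exact Finset.sum_comm

theorem link_add {F : Type*} (X : Matrix (n × F) (n × F) ℂ) (A B : Matrix n n ℂ) :
    link X (A + B) = link X A + link X B := by
  ext
  simp [link, mul_add, Finset.sum_add_distrib]

theorem link_neg {F : Type*} (X : Matrix (n × F) (n × F) ℂ) (A : Matrix n n ℂ) :
    link X (-A) = -link X A := by
  ext
  simp [link]

theorem neg_add_eq_of_mul_conjTranspose {C Θ : Matrix n n ℂ} (hH : H.IsHermitian)
    (hHC : -(H * C + C * H) = Θ) (hΦ : Φ * Φᴴ = C) {h : Matrix (Fin q) (Fin q) ℂ}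
    (hh : h.IsHermitian) :
    (H * Φ + Complex.I • (Φ * h)) * Φᴴ + Φ * (H * Φ + Complex.I • (Φ * h))ᴴ = -Θ := by
  rw [← hHC, neg_neg, ← hΦ, conjTranspose_add, conjTranspose_smul, conjTranspose_mul,
    conjTranspose_mul, hH.eq, hh.eq, Matrix.add_mul, Matrix.mul_add, Complex.star_def,
    Complex.conj_I, neg_smul, Matrix.mul_neg, Matrix.smul_mul, Matrix.mul_smul]
  simp only [Matrix.mul_assoc]
  abel

theorem trace_two_smul_add_mul {F p : Type*} [Fintype F] [Fintype p] {S : Matrix F F ℂ}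
    (hS : S.IsHermitian) (P Q : Matrix F p ℂ) :
    (((2 : ℂ) • P + S * Q) * ((2 : ℂ) • P + S * Q)ᴴ).trace =
      4 * (P * Pᴴ).trace + 2 * (S * (P * Qᴴ)).trace + 2 * (S * (Q * Pᴴ)).trace +
        (Q * Qᴴ * (S * S)).trace := by
  have h1 : (P * (Qᴴ * S)).trace = (S * (P * Qᴴ)).trace := by
    rw [← Matrix.mul_assoc, trace_mul_comm]
  have h2 : (S * (Q * (Qᴴ * S))).trace = (Q * Qᴴ * (S * S)).trace := by
    rw [trace_mul_comm]
    simp only [Matrix.mul_assoc]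
  simp only [conjTranspose_add, conjTranspose_smul, conjTranspose_mul, hS.eq,
    Matrix.add_mul, Matrix.mul_add, trace_add, Matrix.smul_mul, Matrix.mul_smul, trace_smul,
    Matrix.mul_assoc, smul_eq_mul, h1, h2, star_ofNat]
  ring

theorem information_le {F : Type*} [Fintype F] {C Θ : Matrix n n ℂ}
    (hH : H.IsHermitian) (hHC : -(H * C + C * H) = Θ) (hΦ : Φ * Φᴴ = C)
    {X : Matrix (n × F) (n × F) ℂ} (hX : X.PosSemidef) {S : Matrix F F ℂ} (hS : S.IsHermitian)
    (hXS : link X Θ = (1 / 2 : ℂ) • (link X C * S + S * link X C))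
    {h : Matrix (Fin q) (Fin q) ℂ} (hh : h.IsHermitian) :
    (link X C * (S * S)).trace.re ≤ (traceF X * Omega H Φ h).trace.re := by
  obtain ⟨m, L, rfl⟩ := PosSemidef.exists_eq_mul_conjTranspose hX
  let l : Fin m → Matrix n F ℂ := fun k => Matrix.of fun x f => L (x, f) k
  let Y := H * Φ + Complex.I • (Φ * conj h)
  have hlink : ∀ A, link (L * Lᴴ) A = ∑ k, (l k)ᵀ * A * conj (l k) := link_eq_sum L
  have hY : link (L * Lᴴ) (Y * Φᴴ) + link (L * Lᴴ) (Φ * Yᴴ) = -link (L * Lᴴ) Θ := by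
    rw [← link_add, ← link_neg,
      neg_add_eq_of_mul_conjTranspose hH hHC hΦ (isHermitian_conj hh)]
  have hΩ : (traceF (L * Lᴴ) * Omega H Φ h).trace.re =
      ∑ k, 4 * (((l k)ᵀ * Y) * ((l k)ᵀ * Y)ᴴ).trace.re := by
    rw [traceF_eq_sum, Matrix.sum_mul, trace_sum, Complex.re_sum]
    refine Finset.sum_congr rfl fun k _ => ?_
    rw [trace_mul_Omega]
    simp only [Y, Matrix.mul_add, Matrix.mul_smul, Matrix.mul_assoc, l]
  -- The completed square: expanded and summed over `k` it is `tr (W Ω(h)) - 2 tr (ρ̄ S²) + tr (ρ̄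
  -- S²)`, the cross terms being evaluated by `hS1`.
  have hpos := Finset.sum_nonneg fun (k : Fin m) (_ : k ∈ Finset.univ) =>
    trace_mul_conjTranspose_re_nonneg ((2 : ℂ) • ((l k)ᵀ * Y) + S * ((l k)ᵀ * Φ))
  have hprod : ∀ (k : Fin m) (A B : Matrix n (Fin q) ℂ),
      ((l k)ᵀ * A) * ((l k)ᵀ * B)ᴴ = (l k)ᵀ * (A * Bᴴ) * conj (l k) := fun k A B => by
    have hl : (l k)ᵀᴴ = conj (l k) := rfl
    rw [conjTranspose_mul, hl]
    simp only [Matrix.mul_assoc]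
  have hS1 : (S * link (L * Lᴴ) (Y * Φᴴ)).trace + (S * link (L * Lᴴ) (Φ * Yᴴ)).trace =
      -(link (L * Lᴴ) C * (S * S)).trace := by
    have h1 : (S * (link (L * Lᴴ) C * S)).trace = (link (L * Lᴴ) C * (S * S)).trace := by
      rw [trace_mul_comm, Matrix.mul_assoc]
    have h2 : (S * (S * link (L * Lᴴ) C)).trace = (link (L * Lᴴ) C * (S * S)).trace := by
      rw [← Matrix.mul_assoc, trace_mul_comm]
    rw [← trace_add, ← Matrix.mul_add, hY, hXS, Matrix.mul_neg, Matrix.mul_smul, Matrix.mul_add,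
      trace_neg, trace_smul, trace_add, h1, h2, smul_eq_mul]
    ring
  simp only [trace_two_smul_add_mul hS, Complex.add_re, Finset.sum_add_distrib] at hpos
  rw [← Complex.re_sum (f := fun k => 2 * (S * ((l k)ᵀ * Y * ((l k)ᵀ * Φ)ᴴ)).trace),
    ← Complex.re_sum (f := fun k => 2 * (S * ((l k)ᵀ * Φ * ((l k)ᵀ * Y)ᴴ)).trace),
    ← Complex.re_sum (f := fun k => ((l k)ᵀ * Φ * ((l k)ᵀ * Φ)ᴴ * (S * S)).trace)] at hpos
  simp only [← Finset.mul_sum, ← trace_sum, ← Matrix.sum_mul] at hpos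
  simp only [hprod _ Y Φ, hprod _ Φ Y, hprod _ Φ Φ] at hpos
  rw [← hlink, ← hlink, ← hlink, hΦ] at hpos
  have hS2 := congrArg Complex.re hS1
  have h4 : ∑ k, (4 * ((l k)ᵀ * Y * ((l k)ᵀ * Y)ᴴ).trace).re =
      (traceF (L * Lᴴ) * Omega H Φ h).trace.re := by
    rw [hΩ]
    refine Finset.sum_congr rfl fun k _ => ?_
    simp
  rw [h4] at hpos
  simp only [Complex.add_re, Complex.neg_re, Complex.mul_re, Complex.re_ofNat, Complex.im_ofNat,
    zero_mul, sub_zero] at hS2 hpos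
  linarith

/-- For a given reduced operator a pure strategy gains the minimum of `tr (W Ω(h))`. -/
theorem exists_information_eq {C Θ : Matrix n n ℂ}
    (hH : H.IsHermitian) (hHC : -(H * C + C * H) = Θ) (hΦ : Φ * Φᴴ = C)
    (hker : ∀ U : Matrix (Fin q) n ℂ, U * Φ = 0 → U * (H * Φ) = 0)
    {m : ℕ} (L : Matrix n (Fin m) ℂ) :
    ∃ h : Matrix (Fin q) (Fin q) ℂ, h.IsHermitian ∧
      (∀ h' : Matrix (Fin q) (Fin q) ℂ, h'.IsHermitian →
        (L * Lᴴ * Omega H Φ h).trace.re ≤ (L * Lᴴ * Omega H Φ h').trace.re) ∧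
      (∃ S : Matrix (Fin m) (Fin m) ℂ, S.IsHermitian ∧
        Lᵀ * Θ * conj L = (1 / 2 : ℂ) • (Lᵀ * C * conj L * S + S * (Lᵀ * C * conj L)) ∧
        (L * Lᴴ * Omega H Φ h).trace.re = (Lᵀ * C * conj L * (S * S)).trace.re) ∧
      ∃ (B : Matrix (Fin q) n ℂ) (D : Matrix (Fin q) (Fin q) ℂ),
        (Matrix.fromBlocks (L * Lᴴ) Bᴴ B D).PosSemidef ∧ (B * conj Φ).IsHermitian ∧
        (L * Lᴴ * Omega H Φ h).trace.re =
          -D.trace.re - 4 * (conj H * conj Φ * B).trace.re := by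
  obtain ⟨h, hh, hK⟩ := exists_isHermitian_mul (Lᵀ * Φ) (Lᵀ * (H * Φ))
  set K := Lᵀ * (H * Φ) + Complex.I • (Lᵀ * Φ * h) with hKdef
  have hKY : K = Lᵀ * (H * Φ + Complex.I • (Φ * h)) := by
    rw [hKdef, Matrix.mul_add, Matrix.mul_smul, Matrix.mul_assoc]
  have hlc : Lᵀᴴ = conj L := rfl
  have hΩ : (L * Lᴴ * Omega H Φ (conj h)).trace.re = 4 * (K * Kᴴ).trace.re := by
    rw [trace_mul_Omega, conj_conj]
  refine ⟨conj h, isHermitian_conj hh, fun h' hh' => ?_, ?_, ?_⟩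
  · rw [hΩ, trace_mul_Omega]
    have := trace_le_of_isHermitian hh hK (isHermitian_conj hh')
    linarith
  -- Equality in `information_le` requires the square to vanish, that is `S G = -2 K`; `hker`
  -- supplies the range condition.
  · obtain ⟨S, hS, hSG⟩ := exists_isHermitian_mul_eq hK fun U hU => by
      have h1 : U * Lᵀ * Φ = 0 := by rw [Matrix.mul_assoc, hU]
      have h2 := hker _ h1
      rw [hKY, ← Matrix.mul_assoc, Matrix.mul_add, h2, Matrix.mul_smul, ← Matrix.mul_assoc, h1]
      simp
    have hGG : Lᵀ * C * conj L = Lᵀ * Φ * (Lᵀ * Φ)ᴴ := by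
      rw [← hΦ, conjTranspose_mul, hlc]
      simp only [Matrix.mul_assoc]
    have hKG : K * (Lᵀ * Φ)ᴴ + Lᵀ * Φ * Kᴴ = -(Lᵀ * Θ * conj L) := by
      have := neg_add_eq_of_mul_conjTranspose hH hHC hΦ hh
      rw [← Matrix.neg_mul, ← Matrix.mul_neg, ← this, hKY, conjTranspose_mul, conjTranspose_mul,
        hlc]
      generalize H * Φ + Complex.I • (Φ * h) = Y
      simp only [Matrix.mul_assoc, Matrix.mul_add, Matrix.add_mul]
    have hGS : (Lᵀ * Φ)ᴴ * S = -((2 : ℂ) • Kᴴ) := by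
      have := congrArg conjTranspose hSG
      rw [conjTranspose_mul, hS.eq, conjTranspose_neg, conjTranspose_smul] at this
      rw [this]
      simp
    refine ⟨S, hS, ?_, ?_⟩
    · rw [hGG, ← Matrix.mul_assoc S, hSG, Matrix.mul_assoc _ _ S, hGS, Matrix.mul_neg,
        Matrix.neg_mul, Matrix.smul_mul, Matrix.mul_smul, ← neg_add, ← smul_add, smul_neg,
        smul_smul, add_comm, hKG]
      simp
    · rw [hΩ, hGG, trace_mul_comm _ (S * S)]
      have : S * S * (Lᵀ * Φ * (Lᵀ * Φ)ᴴ) = S * (S * (Lᵀ * Φ) * (Lᵀ * Φ)ᴴ) := by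
        simp only [Matrix.mul_assoc]
      rw [this, trace_mul_comm S, Matrix.mul_assoc, hGS, hSG]
      simp only [Matrix.neg_mul, Matrix.mul_neg, Matrix.smul_mul, Matrix.mul_smul]
      norm_num
      ring
  -- The block matrix is the Gram matrix of the rows `L` and `-2 (conj K)†`. This saturates weak
  -- duality, in which the vector `(2 Z, 1)` is tested.
  · refine ⟨(-2 : ℂ) • ((conj K)ᴴ * Lᴴ), (4 : ℂ) • ((conj K)ᴴ * conj K), ?_, ?_, ?_⟩
    · have : Matrix.fromBlocks (L * Lᴴ) ((-2 : ℂ) • ((conj K)ᴴ * Lᴴ))ᴴ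
          ((-2 : ℂ) • ((conj K)ᴴ * Lᴴ)) ((4 : ℂ) • ((conj K)ᴴ * conj K)) =
          (Matrix.fromRows L ((-2 : ℂ) • (conj K)ᴴ)) *
            (Matrix.fromRows L ((-2 : ℂ) • (conj K)ᴴ))ᴴ := by
        rw [conjTranspose_fromRows_eq_fromCols_conjTranspose, fromRows_mul_fromCols]
        congr 1
        · simp
        · simp
        · simp only [conjTranspose_smul, conjTranspose_conjTranspose, Matrix.smul_mul,
            Matrix.mul_smul, smul_smul]
          norm_num
      rw [this]
      exact posSemidef_self_mul_conjTranspose _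
    · have h1 : (-2 : ℂ) • ((conj K)ᴴ * Lᴴ) * conj Φ = (-2 : ℂ) • conj ((Lᵀ * Φ)ᴴ * K)ᴴ := by
        rw [conjTranspose_mul, conjTranspose_conjTranspose, conj_mul, conj_mul, conj_transpose,
          conj_conjTranspose, Matrix.smul_mul, Matrix.mul_assoc]
      rw [h1, IsHermitian, conjTranspose_smul, hK.eq, (isHermitian_conj hK).eq]
      simp
    · have h1 : (conj H * conj Φ * ((-2 : ℂ) • ((conj K)ᴴ * Lᴴ))).trace.re =
          -2 * (Lᵀ * (H * Φ) * Kᴴ).trace.re := by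
        rw [← trace_conj_re (Lᵀ * _ * _), conj_mul, conj_mul, conj_mul, conj_transpose,
          conj_conjTranspose, Matrix.mul_smul, trace_smul, Matrix.mul_assoc Lᴴ,
          trace_mul_comm Lᴴ]
        simp [Matrix.mul_assoc]
      -- The part of `K` containing `h` is orthogonal to `K`, by the normal equations.
      have h2 : (Lᵀ * (H * Φ) * Kᴴ).trace.re = (K * Kᴴ).trace.re := by
        have h3 : Lᵀ * (H * Φ) = K - Complex.I • (Lᵀ * Φ * h) := by
          rw [hKdef, add_sub_cancel_right]
        have h4 : (Lᵀ * Φ * h * Kᴴ).trace = (h * ((Lᵀ * Φ)ᴴ * K)).trace := by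
          rw [Matrix.mul_assoc, trace_mul_comm, Matrix.mul_assoc, ← hK.eq, conjTranspose_mul,
            conjTranspose_conjTranspose]
        rw [h3, Matrix.sub_mul, Matrix.smul_mul, trace_sub, trace_smul, h4, Complex.sub_re,
          smul_eq_mul, Complex.I_mul_re, trace_mul_im_eq_zero hh hK]
        simp
      have h5 : ((4 : ℂ) • ((conj K)ᴴ * conj K)).trace.re = 4 * (K * Kᴴ).trace.re := by
        rw [trace_smul, trace_mul_comm, ← conj_conjTranspose, ← conj_mul, ← trace_conj_re (K * Kᴴ)]
        simp
      rw [h1, h2, h5, hΩ]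
      ring

/-- Weak duality between `B, D` and `h`. -/
theorem le_of_posSemidef_fromBlocks {W : Matrix n n ℂ} {B : Matrix (Fin q) n ℂ}
    {D : Matrix (Fin q) (Fin q) ℂ} (hBD : (Matrix.fromBlocks W Bᴴ B D).PosSemidef)
    (hB : (B * conj Φ).IsHermitian) {h : Matrix (Fin q) (Fin q) ℂ} (hh : h.IsHermitian) :
    -D.trace.re - 4 * (conj H * conj Φ * B).trace.re ≤ (W * Omega H Φ h).trace.re := by
  set Z := conj H * conj Φ - Complex.I • (conj Φ * h) with hZ
  -- Compression by the column `(2 Z, 1)` gives `4 tr (Z† W Z) + 4 Re tr (B Z) + tr D ≥ 0`. The part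
  -- of `Z` with `h` drops out of `Re tr (B Z)`, since `tr (h B Φ*)` is real.
  have h1 := (hBD.conjTranspose_mul_mul_same (Matrix.fromRows ((2 : ℂ) • Z) 1)).trace_nonneg
  rw [conjTranspose_fromRows_eq_fromCols_conjTranspose, fromCols_mul_fromBlocks,
    fromCols_mul_fromRows] at h1
  have h2 : (conj Φ * h * B).trace.im = 0 := by
    rw [Matrix.mul_assoc, trace_mul_comm, Matrix.mul_assoc]
    exact trace_mul_im_eq_zero hh hB
  have h3 : (conj H * conj Φ * B).trace.re = (B * Z).trace.re := by
    rw [trace_mul_comm B, hZ, Matrix.sub_mul, Matrix.smul_mul, trace_sub, trace_smul,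
      Complex.sub_re, smul_eq_mul, Complex.I_mul_re, h2]
    simp
  have h4 : (Zᴴ * Bᴴ).trace.re = (B * Z).trace.re := by
    rw [← conjTranspose_mul, trace_conjTranspose]
    simp
  have h5 : (W * Omega H Φ h).trace = 4 * (Zᴴ * W * Z).trace := by
    rw [Omega, Matrix.mul_smul, trace_smul, ← Matrix.mul_assoc, trace_mul_comm,
      ← Matrix.mul_assoc, smul_eq_mul]
  have h6 := (Complex.le_def.1 h1).1
  simp only [conjTranspose_smul, Matrix.add_mul, Matrix.smul_mul, Matrix.mul_smul, trace_add,
    trace_smul, conjTranspose_one, Matrix.one_mul, Matrix.mul_one, Complex.add_re, smul_eq_mul,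
    star_ofNat, Complex.mul_re, Complex.re_ofNat, Complex.im_ofNat, zero_mul, sub_zero,
    Complex.zero_re, h4] at h6
  rw [h3, h5]
  simp only [Complex.mul_re, Complex.re_ofNat, Complex.im_ofNat, zero_mul, sub_zero]
  linarith

end Information

/-! ### Averages of Choi operators -/

/-- Used twice: it bounds Choi operators uniformly in `θ`, which gives integrability, and it bounds
the feasible set, which gives compactness. -/
theorem PosSemidef.norm_apply_le_trace {n : Type*} [Fintype n] {M : Matrix n n ℂ}
    (hM : M.PosSemidef) (x y : n) : ‖M x y‖ ≤ M.trace.re := by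
  obtain ⟨m, L, rfl⟩ := PosSemidef.exists_eq_mul_conjTranspose hM
  have hd : ∀ x, ((L * Lᴴ) x x).re = ∑ k, ‖L x k‖ ^ 2 := fun x => by
    rw [Matrix.mul_apply, Complex.re_sum]
    refine Finset.sum_congr rfl fun k _ => ?_
    rw [conjTranspose_apply, Complex.star_def, Complex.mul_conj, Complex.normSq_eq_norm_sq,
      Complex.ofReal_re]
  have ht : ∀ x, ((L * Lᴴ) x x).re ≤ (L * Lᴴ).trace.re := fun x => by
    rw [Matrix.trace, Complex.re_sum]
    exact Finset.single_le_sum (f := fun x => ((L * Lᴴ) x x).re)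
      (fun x _ => by rw [hd]; positivity) (Finset.mem_univ x)
  have h : ‖(L * Lᴴ) x y‖ ≤ ∑ k, (‖L x k‖ ^ 2 + ‖L y k‖ ^ 2) / 2 := by
    rw [Matrix.mul_apply]
    refine (norm_sum_le _ _).trans (Finset.sum_le_sum fun k _ => ?_)
    rw [norm_mul, conjTranspose_apply, norm_star]
    nlinarith [sq_nonneg (‖L x k‖ - ‖L y k‖)]
  rw [← Finset.sum_div, Finset.sum_add_distrib, ← hd, ← hd] at h
  linarith [ht x, ht y]

theorem posSemidef_tensor {N : ℕ} {D : Fin N → Matrix (I × O) (I × O) ℂ}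
    (hD : ∀ j, (D j).PosSemidef) : (tensor D).PosSemidef := by
  choose m L hL using fun j => PosSemidef.exists_eq_mul_conjTranspose (hD j)
  let K : Matrix (Fin N → I × O) (∀ j, Fin (m j)) ℂ := Matrix.of fun x k => ∏ j, L j (x j) (k j)
  have : tensor D = K * Kᴴ := by
    ext x y
    simp only [tensor, Matrix.of_apply, hL, Matrix.mul_apply, K, conjTranspose_apply, star_prod,
      ← Finset.prod_mul_distrib]
    rw [Finset.prod_univ_sum, Fintype.piFinset_univ]
  rw [this]
  exact posSemidef_self_mul_conjTranspose K

section Average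

variable {n : Type*} [Fintype n] {μ : Measure ℝ} {A : ℝ → Matrix n n ℂ}

theorem linearMap_average (hA : ∀ x y, Integrable (fun θ => A θ x y) μ)
    (φ : Matrix n n ℂ →ₗ[ℂ] ℂ) :
    Integrable (fun θ => φ (A θ)) μ ∧ ∫ θ, φ (A θ) ∂μ = φ (average μ A) := by
  classical
  have h : ∀ M : Matrix n n ℂ, φ M = ∑ x, ∑ y, M x y * φ (single x y 1) := fun M => by
    conv_lhs => rw [matrix_eq_sum_single M]
    simp only [map_sum]
    refine Finset.sum_congr rfl fun x _ => Finset.sum_congr rfl fun y _ => ?_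
    rw [← smul_eq_mul, ← map_smul, smul_single, smul_eq_mul, mul_one]
  have hi : ∀ x y, Integrable (fun θ => A θ x y * φ (single x y 1)) μ :=
    fun x y => (hA x y).mul_const _
  simp only [h (A _)]
  refine ⟨integrable_finsetSum _ fun x _ => integrable_finsetSum _ fun y _ => hi x y, ?_⟩
  rw [h, integral_finsetSum _ fun x _ => integrable_finsetSum _ fun y _ => hi x y]
  refine Finset.sum_congr rfl fun x _ => ?_
  rw [integral_finsetSum _ fun y _ => hi x y]
  refine Finset.sum_congr rfl fun y _ => ?_
  rw [integral_mul_const]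
  rfl

theorem average_link {F : Type*} (hA : ∀ x y, Integrable (fun θ => A θ x y) μ)
    (X : Matrix (n × F) (n × F) ℂ) :
    average μ (fun θ => link X (A θ)) = link X (average μ A) := by
  ext f g
  let φ : Matrix n n ℂ →ₗ[ℂ] ℂ :=
    { toFun := fun C => link X C f g
      map_add' := fun C D => by simp [link, mul_add, Finset.sum_add_distrib]
      map_smul' := fun c C => by simp [link, Finset.mul_sum, mul_left_comm] }
  exact (linearMap_average hA φ).2

/-- The nonnegative function `tr (U A_θ U†)` has integral zero, so `U A_θ = 0` for almost every `θ`,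
and the weight `θ` does no harm. -/
theorem mul_average_smul_eq_zero {p : Type*} [Fintype p]
    (hA : ∀ x y, Integrable (fun θ => A θ x y) μ)
    (hθA : ∀ x y, Integrable (fun θ : ℝ => ((θ : ℂ) • A θ) x y) μ) (hpos : ∀ θ, (A θ).PosSemidef)
    {U : Matrix p n ℂ} (hU : U * average μ A = 0) :
    U * average μ (fun θ => (θ : ℂ) • A θ) = 0 := by
  let φ : Matrix n n ℂ →ₗ[ℂ] ℂ :=
    { toFun := fun C => (U * C * Uᴴ).trace
      map_add' := fun C D => by simp [Matrix.mul_add, Matrix.add_mul]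
      map_smul' := fun c C => by simp }
  obtain ⟨h1, h2⟩ := linearMap_average hA φ
  have h3 : ∫ θ, (φ (A θ)).re ∂μ = 0 := by
    have := integral_re h1
    simp only [RCLike.re_to_complex] at this
    rw [this, h2]
    simp [φ, hU]
  have hnn : ∀ θ, 0 ≤ (φ (A θ)).re := fun θ =>
    (Complex.le_def.1 ((hpos θ).mul_mul_conjTranspose_same U).trace_nonneg).1
  have h4 := (integral_eq_zero_iff_of_nonneg hnn h1.re).1 h3
  have h5 : ∀ᵐ θ ∂μ, U * A θ = 0 := by
    filter_upwards [h4] with θ hθ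
    obtain ⟨m, L, hL⟩ := PosSemidef.exists_eq_mul_conjTranspose (hpos θ)
    have h6 : U * L = 0 := eq_zero_of_trace_mul_conjTranspose_re (by
      have : (U * L) * (U * L)ᴴ = U * A θ * Uᴴ := by
        rw [hL, conjTranspose_mul]
        simp only [Matrix.mul_assoc]
      rw [this]
      exact hθ.le)
    rw [hL, ← Matrix.mul_assoc, h6, Matrix.zero_mul]
  ext i y
  let ψ : Matrix n n ℂ →ₗ[ℂ] ℂ :=
    { toFun := fun C => (U * C) i y
      map_add' := fun C D => by simp [Matrix.mul_add]
      map_smul' := fun c C => by simp }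
  refine (linearMap_average hθA ψ).2.symm.trans ?_
  rw [Matrix.zero_apply]
  refine integral_eq_zero_of_ae ?_
  filter_upwards [h5] with θ hθ
  simp [ψ, hθ]

end Average

section Channels

variable {μ : Measure ℝ} [IsProbabilityMeasure μ] {E : ℝ → (Matrix I I ℂ →ₗ[ℂ] Matrix O O ℂ)}

theorem posSemidef_tensor_choi (hE : ∀ θ, IsChannel (E θ)) (N : ℕ) (θ : ℝ) :
    (tensor fun _ : Fin N => choi (E θ)).PosSemidef :=
  posSemidef_tensor fun _ => (hE θ).isChoi.1

theorem norm_tensor_choi_le (hE : ∀ θ, IsChannel (E θ)) (N : ℕ) (x y : Fin N → I × O) (θ : ℝ) :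
    ‖tensor (fun _ => choi (E θ)) x y‖ ≤ (Fintype.card I : ℝ) ^ N := by
  refine (PosSemidef.norm_apply_le_trace (posSemidef_tensor_choi hE N θ) x y).trans (le_of_eq ?_)
  rw [trace_tensor]
  simp only [(hE θ).isChoi.trace, Finset.prod_const, Finset.card_univ, Fintype.card_fin]
  rw [← Nat.cast_pow, Complex.natCast_re, Nat.cast_pow]

theorem aestronglyMeasurable_tensor_choi
    (hEm : ∀ a b, AEStronglyMeasurable (fun θ => choi (E θ) a b) μ) (N : ℕ)
    (x y : Fin N → I × O) :
    AEStronglyMeasurable (fun θ => tensor (fun _ => choi (E θ)) x y) μ :=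
  Finset.aestronglyMeasurable_fun_prod Finset.univ fun j _ => hEm (x j) (y j)

theorem integrable_tensor_choi (hE : ∀ θ, IsChannel (E θ))
    (hEm : ∀ a b, AEStronglyMeasurable (fun θ => choi (E θ) a b) μ) (N : ℕ)
    (x y : Fin N → I × O) : Integrable (fun θ => tensor (fun _ => choi (E θ)) x y) μ :=
  Integrable.of_bound (aestronglyMeasurable_tensor_choi hEm N x y) _
    (Filter.Eventually.of_forall (norm_tensor_choi_le hE N x y))

theorem integrable_smul_tensor_choi (hμ : Integrable (fun θ : ℝ => θ) μ)
    (hE : ∀ θ, IsChannel (E θ))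
    (hEm : ∀ a b, AEStronglyMeasurable (fun θ => choi (E θ) a b) μ) (N : ℕ)
    (x y : Fin N → I × O) :
    Integrable (fun θ : ℝ => ((θ : ℂ) • tensor (fun _ => choi (E θ))) x y) μ :=
  hμ.ofReal.mul_bdd (aestronglyMeasurable_tensor_choi hEm N x y)
    (Filter.Eventually.of_forall (norm_tensor_choi_le hE N x y))

theorem average_outputState (hE : ∀ θ, IsChannel (E θ))
    (hEm : ∀ a b, AEStronglyMeasurable (fun θ => choi (E θ) a b) μ) {N : ℕ} {F : Type*}
    (X : Matrix ((Fin N → I × O) × F) ((Fin N → I × O) × F) ℂ) :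
    average μ (outputState E X) = link X (avgChoi N μ E) :=
  average_link (integrable_tensor_choi hE hEm N) X

theorem average_smul_outputState (hμ : Integrable (fun θ : ℝ => θ) μ)
    (hE : ∀ θ, IsChannel (E θ))
    (hEm : ∀ a b, AEStronglyMeasurable (fun θ => choi (E θ) a b) μ) {N : ℕ} {F : Type*}
    (X : Matrix ((Fin N → I × O) × F) ((Fin N → I × O) × F) ℂ) :
    average μ (fun θ => (θ : ℂ) • outputState E X θ) = link X (avgThetaChoi N μ E) := by
  rw [avgThetaChoi, ← average_link (integrable_smul_tensor_choi hμ hE hEm N)]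
  congr 1
  funext θ
  ext f g
  simp [outputState, link, Finset.mul_sum, mul_left_comm]

/-- From `U C = 0` and `U Θ = 0` the equation for `H` leaves `U H C = 0`, and `(U H Φ)(U H Φ)† = U H
C H† U†`. -/
theorem mul_mul_eq_zero_of_mul_eq_zero (hμ : Integrable (fun θ : ℝ => θ) μ)
    (hE : ∀ θ, IsChannel (E θ))
    (hEm : ∀ a b, AEStronglyMeasurable (fun θ => choi (E θ) a b) μ) {N q : ℕ}
    {H : Matrix (Fin N → I × O) (Fin N → I × O) ℂ}
    (hHC : -(H * avgChoi N μ E + avgChoi N μ E * H) = avgThetaChoi N μ E)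
    {Φ : Matrix (Fin N → I × O) (Fin q) ℂ} (hΦ : Φ * Φᴴ = avgChoi N μ E)
    {p : Type*} [Fintype p] {U : Matrix p (Fin N → I × O) ℂ} (hU : U * Φ = 0) :
    U * (H * Φ) = 0 := by
  have hC : U * avgChoi N μ E = 0 := by rw [← hΦ, ← Matrix.mul_assoc, hU, Matrix.zero_mul]
  have hT : U * avgThetaChoi N μ E = 0 :=
    mul_average_smul_eq_zero (integrable_tensor_choi hE hEm N)
      (integrable_smul_tensor_choi hμ hE hEm N) (posSemidef_tensor_choi hE N) hC
  rw [← hHC, Matrix.mul_neg, neg_eq_zero, Matrix.mul_add, ← Matrix.mul_assoc, ← Matrix.mul_assoc,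
    hC, Matrix.zero_mul, add_zero, ← hΦ] at hT
  rw [← self_mul_conjTranspose_eq_zero, conjTranspose_mul, conjTranspose_mul]
  have : U * (H * Φ) * (Φᴴ * Hᴴ * Uᴴ) = U * H * (Φ * Φᴴ) * (Hᴴ * Uᴴ) := by
    simp only [Matrix.mul_assoc]
  rw [this, hT, Matrix.zero_mul]

end Channels

/-! ### The reduced operators of strategies -/

/-- The positive operators satisfying the linear constraints of the semidefinite program. -/
def reducedSet (I O : Type*) [Fintype I] [DecidableEq I] [Fintype O] [DecidableEq O]
    (N : ℕ) (k : StrategyType) : Set (Matrix (Fin N → I × O) (Fin N → I × O) ℂ) :=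
  {W | W.PosSemidef ∧ Lam N k W = W ∧ W.trace = (Fintype.card O : ℂ) ^ N}

theorem trace_link {n F : Type*} [Fintype n] [Fintype F] (X : Matrix (n × F) (n × F) ℂ)
    (D : Matrix n n ℂ) : (link X D).trace = pairing D (traceF X) := by
  simp only [Matrix.trace, Matrix.diag, link, Matrix.of_apply, pairing_apply, traceF,
    Finset.sum_mul]
  rw [Finset.sum_comm]
  exact Finset.sum_congr rfl fun x _ => Finset.sum_comm

theorem posSemidef_traceF {n F : Type*} [Fintype n] [Fintype F] {X : Matrix (n × F) (n × F) ℂ}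
    (hX : X.PosSemidef) : (traceF X).PosSemidef := by
  obtain ⟨m, L, rfl⟩ := PosSemidef.exists_eq_mul_conjTranspose hX
  rw [traceF_eq_sum]
  exact posSemidef_sum _ fun k _ => posSemidef_self_mul_conjTranspose _

theorem isStrategy_iff [Nonempty I] [Nonempty O] {N : ℕ} {F : Type*} [Fintype F]
    (k : StrategyType) (X : Matrix ((Fin N → I × O) × F) ((Fin N → I × O) × F) ℂ) :
    IsStrategy k X ↔ X.PosSemidef ∧ traceF X ∈ reducedSet I O N k := by
  unfold IsStrategy
  refine and_congr_right fun hX => ?_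
  rw [reducedSet, Set.mem_ofPred_eq, and_iff_right (posSemidef_traceF hX)]
  cases k with
  | parallel => exact isParallel_iff _
  | sequential => exact isComb_iff _
  | indefinite =>
    rw [← indefinite_iff]
    simp only [trace_link]
    constructor
    · intro h D hD
      have := h (fun j => ofChoi (D j)) fun j => (hD j).isChannel
      simpa only [choi_ofChoi] using this
    · exact fun h E hE => h _ fun j => (hE j).isChoi

/-- The pure strategy `|L⟩⟨L|`. -/
def pureStrategy {n F : Type*} (L : Matrix n F ℂ) : Matrix (n × F) (n × F) ℂ :=
  (Matrix.of fun p (_ : Fin 1) => L p.1 p.2) * (Matrix.of fun p (_ : Fin 1) => L p.1 p.2)ᴴ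

section Pure

variable {n F : Type*} [Fintype n] [Fintype F] (L : Matrix n F ℂ)

theorem posSemidef_pureStrategy : (pureStrategy L).PosSemidef :=
  posSemidef_self_mul_conjTranspose _

theorem traceF_pureStrategy : traceF (pureStrategy L) = L * Lᴴ := by
  rw [pureStrategy, traceF_eq_sum, Fin.sum_univ_one]
  rfl

theorem link_pureStrategy (A : Matrix n n ℂ) :
    link (pureStrategy L) A = Lᵀ * A * conj L := by
  rw [pureStrategy, link_eq_sum, Fin.sum_univ_one]
  rfl

end Pure

theorem isStrategy_pureStrategy [Nonempty I] [Nonempty O] {N m : ℕ} {k : StrategyType}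
    {L : Matrix (Fin N → I × O) (Fin m) ℂ} (hL : L * Lᴴ ∈ reducedSet I O N k) :
    IsStrategy k (pureStrategy L) :=
  (isStrategy_iff k _).2 ⟨posSemidef_pureStrategy L, by rwa [traceF_pureStrategy]⟩

/-- Every admissible `W = L L†` is realized by a pure strategy whose output dimension is the number
of columns of `L`. -/
theorem reducedStrategies_eq [Nonempty I] [Nonempty O] (N : ℕ) (k : StrategyType) :
    reducedStrategies I O N k = reducedSet I O N k := by
  ext W
  constructor
  · rintro ⟨f, X, hX, rfl⟩
    exact ((isStrategy_iff k X).1 hX).2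
  · intro hW
    obtain ⟨m, L, rfl⟩ := PosSemidef.exists_eq_mul_conjTranspose hW.1
    exact ⟨m, pureStrategy L, isStrategy_pureStrategy hW, (traceF_pureStrategy L).symm⟩

/-! ### Nonemptiness and compactness of the set of reduced operators. -/

theorem tensor_one (N : ℕ) : tensor (fun _ : Fin N => (1 : Matrix (I × O) (I × O) ℂ)) = 1 := by
  have := tensor_smul_one (I := I) (O := O) (N := N) 1
  simpa using this

theorem replaceO_one [Nonempty O] {N : ℕ} (j : Fin N) :
    replaceO j (1 : Matrix (Fin N → I × O) (Fin N → I × O) ℂ) = 1 := by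
  have h : siteO (1 : Matrix (I × O) (I × O) ℂ) = 1 := by
    ext a b
    rw [siteO_eq_traceF, traceF_one]
    by_cases h1 : a.1 = b.1 <;> by_cases h2 : a.2 = b.2 <;>
      simp [Matrix.one_apply, h1, h2, Prod.ext_iff]
  rw [← tensor_one, replaceO_tensor, h, Function.update_eq_self]

theorem replaceI_one [Nonempty I] {N : ℕ} (j : Fin N) :
    replaceI j (1 : Matrix (Fin N → I × O) (Fin N → I × O) ℂ) = 1 := by
  have h : siteI (1 : Matrix (I × O) (I × O) ℂ) = 1 := by
    ext a b
    rw [siteI_apply]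
    by_cases h1 : a.1 = b.1 <;> by_cases h2 : a.2 = b.2 <;>
      simp [Matrix.one_apply, h1, h2, Prod.ext_iff]
  rw [← tensor_one, replaceI_tensor, h, Function.update_eq_self]

theorem list_prod_apply_eq_self {M ι : Type*} [AddCommMonoid M] [Module ℂ M] (l : List ι)
    (T : ι → Module.End ℂ M) {v : M} (h : ∀ i, T i v = v) : (l.map T).prod v = v := by
  induction l with
  | nil => rfl
  | cons a l ih => rw [List.map_cons, List.prod_cons, Module.End.mul_apply, ih, h]

theorem Lam_one [Nonempty I] [Nonempty O] (N : ℕ) (k : StrategyType) :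
    Lam N k (1 : Matrix (Fin N → I × O) (Fin N → I × O) ℂ) = 1 := by
  have hrep : ∀ j : Fin N, (replaceI j * replaceO j :
      Module.End ℂ (Matrix (Fin N → I × O) (Fin N → I × O) ℂ)) 1 = 1 := fun j => by
    rw [Module.End.mul_apply, replaceO_one, replaceI_one]
  cases k with
  | parallel => exact list_prod_apply_eq_self _ _ replaceO_one
  | sequential =>
    rw [Lam_sequential_eq_iff]
    refine Finset.sum_eq_zero fun j _ => ?_
    rw [seqTerm, Module.End.mul_apply, list_prod_apply_eq_self _ _ hrep, LinearMap.sub_apply,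
      Module.End.one_apply, replaceO_one, sub_self]
  | indefinite =>
    change (1 - projectAll N + replaceAll N : Module.End ℂ _) 1 = 1
    rw [LinearMap.add_apply, LinearMap.sub_apply, projectAll, replaceAll,
      list_prod_apply_eq_self _ _ hrep, list_prod_apply_eq_self _ _ fun j => by
        rw [LinearMap.add_apply, LinearMap.sub_apply, hrep, replaceO_one, Module.End.one_apply,
          sub_add_cancel], Module.End.one_apply, sub_add_cancel]

theorem reducedSet_nonempty [Nonempty I] [Nonempty O] (N : ℕ) (k : StrategyType) :
    (reducedSet I O N k).Nonempty := by
  have hI : (Fintype.card I : ℂ) ≠ 0 := by simp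
  refine ⟨((Fintype.card I : ℂ)⁻¹ ^ N) • 1, PosSemidef.one.smul ?_, ?_, ?_⟩
  · exact pow_nonneg (inv_nonneg.2 (Nat.cast_nonneg _)) _
  · rw [map_smul, Lam_one]
  · rw [trace_smul, trace_one]
    simp only [Fintype.card_pi, Finset.prod_const, Finset.card_univ, Fintype.card_fin,
      Fintype.card_prod, Nat.cast_pow, Nat.cast_mul, smul_eq_mul]
    rw [← mul_pow, inv_mul_cancel_left₀ hI]

theorem isClosed_posSemidef {n : Type*} [Fintype n] :
    IsClosed {W : Matrix n n ℂ | W.PosSemidef} := by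
  simp only [posSemidef_iff_dotProduct_mulVec, Set.ofPred_and, Set.ofPred_forall]
  refine IsClosed.inter (isClosed_eq (by fun_prop) (by fun_prop)) (isClosed_iInter fun x => ?_)
  exact isClosed_le (by fun_prop) (by fun_prop)

theorem isCompact_reducedSet (N : ℕ) (k : StrategyType) : IsCompact (reducedSet I O N k) := by
  have hK : IsCompact (Set.univ.pi fun _ : Fin N → I × O => Set.univ.pi fun _ : Fin N → I × O =>
      Metric.closedBall (0 : ℂ) ((Fintype.card O : ℝ) ^ N)) :=
    isCompact_univ_pi fun _ => isCompact_univ_pi fun _ => isCompact_closedBall _ _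
  refine hK.of_isClosed_subset ?_ ?_
  · have hL : Continuous (Lam (I := I) (O := O) N k) := LinearMap.continuous_of_finiteDimensional _
    exact isClosed_posSemidef.inter ((isClosed_eq hL continuous_id).inter
      (isClosed_eq (by fun_prop) continuous_const))
  · rintro W ⟨hW, -, ht⟩ x - y -
    rw [mem_closedBall_zero_iff]
    refine (PosSemidef.norm_apply_le_trace hW x y).trans (le_of_eq ?_)
    rw [ht]
    rw [← Nat.cast_pow, Complex.natCast_re, Nat.cast_pow]

/-! ### The optimum -/

section Optimum

variable {n : Type*} [Fintype n] {q : ℕ}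

/-- The infimum of `tr (W Ω(h))` over Hermitian `h`. -/
def infOmega (H : Matrix n n ℂ) (Φ : Matrix n (Fin q) ℂ) (W : Matrix n n ℂ) : ℝ :=
  ⨅ h : {h : Matrix (Fin q) (Fin q) ℂ // h.IsHermitian}, (W * Omega H Φ h).trace.re

/-- The lower bound makes the real infimum in `infOmega` a genuine one for positive `W`. -/
theorem trace_mul_Omega_nonneg {H : Matrix n n ℂ} {Φ : Matrix n (Fin q) ℂ} {W : Matrix n n ℂ}
    (hW : W.PosSemidef) (h : Matrix (Fin q) (Fin q) ℂ) : 0 ≤ (W * Omega H Φ h).trace.re := by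
  obtain ⟨m, L, rfl⟩ := PosSemidef.exists_eq_mul_conjTranspose hW
  rw [trace_mul_Omega]
  exact mul_nonneg (by norm_num) (trace_mul_conjTranspose_re_nonneg _)

theorem IsLeast.eq_infOmega {H : Matrix n n ℂ} {Φ : Matrix n (Fin q) ℂ} {W : Matrix n n ℂ} {v : ℝ}
    (hv : IsLeast {t : ℝ | ∃ h : Matrix (Fin q) (Fin q) ℂ, h.IsHermitian ∧
      t = (W * Omega H Φ h).trace.re} v) : v = infOmega H Φ W := by
  rw [infOmega, iInf, ← hv.csInf_eq]
  congr 1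
  ext t
  constructor
  · rintro ⟨h, hh, rfl⟩
    exact ⟨⟨h, hh⟩, rfl⟩
  · rintro ⟨⟨h, hh⟩, rfl⟩
    exact ⟨h, hh, rfl⟩

/-- An infimum of continuous functions of `W` is upper semicontinuous and attains its maximum on a
nonempty compact set. -/
theorem exists_isMaxOn_infOmega [Nonempty I] [Nonempty O] (N : ℕ) (k : StrategyType)
    (H : Matrix (Fin N → I × O) (Fin N → I × O) ℂ) (Φ : Matrix (Fin N → I × O) (Fin q) ℂ) :
    ∃ W ∈ reducedSet I O N k, IsMaxOn (infOmega H Φ) (reducedSet I O N k) W := by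
  refine UpperSemicontinuousOn.exists_isMaxOn (reducedSet_nonempty N k) (isCompact_reducedSet N k)
    (upperSemicontinuousOn_ciInf ?_ fun h => ?_)
  · rintro W hW
    refine ⟨0, ?_⟩
    rintro _ ⟨h, rfl⟩
    exact trace_mul_Omega_nonneg hW.1 _
  · have : Continuous fun W : Matrix (Fin N → I × O) (Fin N → I × O) ℂ =>
        (W * Omega H Φ h).trace.re := by fun_prop
    exact this.upperSemicontinuous.upperSemicontinuousOn _

end Optimum

end GlobalEstimation

end

/-! ### The main theorem. -/

theorem mainTheorem3 {I O : Type*} [Fintype I] [DecidableEq I] [Nonempty I]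
    [Fintype O] [DecidableEq O] [Nonempty O] (N : ℕ)
    (μ : MeasureTheory.Measure ℝ) [MeasureTheory.IsProbabilityMeasure μ]
    (hμ : MeasureTheory.Integrable (fun θ : ℝ => θ) μ)
    (E : ℝ → (Matrix I I ℂ →ₗ[ℂ] Matrix O O ℂ))
    (hE : ∀ θ, GlobalEstimation.IsChannel (E θ))
    (hEm : ∀ a b, MeasureTheory.AEStronglyMeasurable
      (fun θ => GlobalEstimation.choi (E θ) a b) μ)
    (H : Matrix (Fin N → I × O) (Fin N → I × O) ℂ) (hH : H.IsHermitian)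
    (hHC : -(H * GlobalEstimation.avgChoi N μ E + GlobalEstimation.avgChoi N μ E * H) =
      GlobalEstimation.avgThetaChoi N μ E)
    (q : ℕ) (Φ : Matrix (Fin N → I × O) (Fin q) ℂ)
    (hΦ : Φ * Φ.conjTranspose = GlobalEstimation.avgChoi N μ E)
    (k : GlobalEstimation.StrategyType) :
    IsLUB (GlobalEstimation.informationValues N k μ E)
        (GlobalEstimation.maxInformation N k μ E) ∧
      IsGreatest (GlobalEstimation.minValues k H Φ)
        (GlobalEstimation.maxInformation N k μ E) ∧
      IsGreatest (GlobalEstimation.primalValues k H Φ)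
        (GlobalEstimation.maxInformation N k μ E) := by
  have hker : ∀ U : Matrix (Fin q) (Fin N → I × O) ℂ, U * Φ = 0 → U * (H * Φ) = 0 :=
    fun U hU => GlobalEstimation.mul_mul_eq_zero_of_mul_eq_zero hμ hE hEm hHC hΦ hU
  obtain ⟨W₀, hW₀, hmax⟩ := GlobalEstimation.exists_isMaxOn_infOmega N k H Φ
  -- One `h` per `W` suffices as a dual certificate: it bounds both the information of every
  -- strategy with this `W` and every program value with this `W`.
  have hmin : ∀ W ∈ GlobalEstimation.reducedSet I O N k,
      ∃ h : Matrix (Fin q) (Fin q) ℂ, h.IsHermitian ∧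
        (W * GlobalEstimation.Omega H Φ h).trace.re ≤ GlobalEstimation.infOmega H Φ W₀ := by
    intro W hW
    obtain ⟨m, L, rfl⟩ := GlobalEstimation.PosSemidef.exists_eq_mul_conjTranspose hW.1
    obtain ⟨h, hh, hle, -⟩ := GlobalEstimation.exists_information_eq hH hHC hΦ hker L
    refine ⟨h, hh, le_trans (le_of_eq ?_) (hmax hW)⟩
    refine GlobalEstimation.IsLeast.eq_infOmega ⟨⟨h, hh, rfl⟩, ?_⟩
    rintro _ ⟨h', hh', rfl⟩
    exact hle h' hh'
  obtain ⟨m, L, rfl⟩ := GlobalEstimation.PosSemidef.exists_eq_mul_conjTranspose hW₀.1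
  obtain ⟨h₀, hh₀, hle, ⟨S, hS, hSeq, hSval⟩, B, D, hBD, hB, hval⟩ :=
    GlobalEstimation.exists_information_eq hH hHC hΦ hker L
  have hleast : IsLeast {t : ℝ | ∃ h : Matrix (Fin q) (Fin q) ℂ, h.IsHermitian ∧
      t = (L * L.conjTranspose * GlobalEstimation.Omega H Φ h).trace.re}
      (L * L.conjTranspose * GlobalEstimation.Omega H Φ h₀).trace.re := by
    refine ⟨⟨h₀, hh₀, rfl⟩, ?_⟩
    rintro _ ⟨h', hh', rfl⟩
    exact hle h' hh'
  have hopt := GlobalEstimation.IsLeast.eq_infOmega hleast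
  have hinfo : IsGreatest (GlobalEstimation.informationValues N k μ E)
      (GlobalEstimation.infOmega H Φ (L * L.conjTranspose)) := by
    constructor
    · refine ⟨m, GlobalEstimation.pureStrategy L,
        GlobalEstimation.isStrategy_pureStrategy hW₀, S, hS, ?_, ?_⟩
      · rw [GlobalEstimation.average_smul_outputState hμ hE hEm,
          GlobalEstimation.average_outputState hE hEm, GlobalEstimation.link_pureStrategy,
          GlobalEstimation.link_pureStrategy, hSeq]
      · rw [GlobalEstimation.average_outputState hE hEm, GlobalEstimation.link_pureStrategy,
          ← hopt, hSval]
    · rintro v ⟨f, X, hX, S, hS, hSeq, rfl⟩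
      rw [GlobalEstimation.average_smul_outputState hμ hE hEm,
        GlobalEstimation.average_outputState hE hEm] at hSeq
      rw [GlobalEstimation.average_outputState hE hEm]
      obtain ⟨hXpos, hXred⟩ := (GlobalEstimation.isStrategy_iff k X).1 hX
      obtain ⟨h, hh, hle⟩ := hmin _ hXred
      exact (GlobalEstimation.information_le hH hHC hΦ hXpos hS hSeq hh).trans hle
  -- The set of information values has a greatest element, so `sSup` is not the default value of an
  -- empty or unbounded set.
  have hJ : GlobalEstimation.maxInformation N k μ E =
      GlobalEstimation.infOmega H Φ (L * L.conjTranspose) := hinfo.csSup_eq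
  rw [hJ]
  refine ⟨hinfo.isLUB, ⟨?_, ?_⟩, ⟨?_, ?_⟩⟩
  · rw [← hopt]
    exact ⟨_, by rwa [GlobalEstimation.reducedStrategies_eq], hleast⟩
  · rintro v ⟨W, hW, hv⟩
    rw [GlobalEstimation.reducedStrategies_eq] at hW
    rw [GlobalEstimation.IsLeast.eq_infOmega hv]
    exact hmax hW
  · rw [← hopt]
    exact ⟨L * L.conjTranspose, B, D, ⟨hW₀.2.1, hW₀.2.2, hBD, hB⟩, hval⟩
  · rintro v ⟨X, B, D, hf, rfl⟩
    -- Positivity of `X` is inherited as that of a principal submatrix of the block matrix.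
    obtain ⟨h, hh, hle⟩ := hmin X ⟨hf.posSemidef.submatrix Sum.inl, hf.fixed, hf.trace_eq⟩
    exact (GlobalEstimation.le_of_posSemidef_fromBlocks hf.posSemidef hf.hermitian hh).trans hle
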